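/- **Equivalence of local isometric embedding and the Darboux equation.** Let $n\in\{2,3,\dots\}\cup\{\infty\}$, let $U\subseteq\mathbb{R}^2$ be open (a coordinate domain with coordinates $x^1,x^2$), and let $g=g_{ij}\,dx^i dx^j$ be a Riemannian metric of class $C^n$ on $U$. Write $|g|=\det(g_{ij})$, $K$ for the Gaussian curvature of $g$, $\nabla_{ij}z=\partial_i\partial_j z-\Gamma^k_{ij}\partial_k z$ for the second covariant derivatives, and $|\nabla_g z|^2=g^{ij}\partial_i z\,\partial_j z$. The Darboux equation for $z$ is $$\det(\nabla_{ij}z)=K\,|g|\,(1-|\nabla_g z|^2).$$ 1. Let $V\subseteq U$ be open and let $F=(z_1,z_2,z_3):V\to\mathbb{R}^3$ be of class $C^2$ with $g=dz_1^2+dz_2^2+dz_3^2$ on $V$ (for example a $C^2$ isometric embedding). Then each of $z_1,z_2,z_3$ satisfies the Darboux equation on $V$. 2. Conversely, let $V\subseteq U$ be open and let $z\in C^n(V)$ satisfy the Darboux equation and $|\nabla_g z|<1$ on $V$. Then $g-dz^2$ is a Riemannian metric of class $C^{n-1}$ on $V$ and it is flat: its Riemann curvature tensor vanishes in the sense of distributions,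 and if $n\ge 3$ its Gaussian curvature vanishes at every point. Moreover every $p\in V$ has an open neighborhood $W\subseteq V$ with a $C^n$ change of coordinates $(z_1,z_2)$ (a homeomorphism of $W$ onto an open subset of $\mathbb{R}^2$, of class $C^n$ with inverse of class $C^n$) such that $g-dz^2=dz_1^2+dz_2^2$ on $W$; and $(z_1,z_2,z):W\to\mathbb{R}^3$ is a $C^n$ isometric embedding of $(W,g)$. 3. Consequently, for every $p\in U$, there is a $C^n$ isometric embedding of some neighborhood of $p$ in $(U,g)$ into $\mathbb{R}^3$ if and only if on some neighborhood of $p$ there is a $C^n$ solution $z$ of the Darboux equation with $|\nabla_g z|<1$. -/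

import Mathlib

open scoped ContDiff

noncomputable section

namespace LocalSurface

/-- The coordinate plane with coordinates `x 0`, `x 1`. -/
abbrev Plane : Type := EuclideanSpace ℝ (Fin 2)

/-- Euclidean three-space. -/
abbrev Space : Type := EuclideanSpace ℝ (Fin 3)

/-- The coordinate partial derivative `∂f/∂xⁱ`. -/
def pd (i : Fin 2) (f : Plane → ℝ) (x : Plane) : ℝ :=
  fderiv ℝ f x (EuclideanSpace.single i 1)

/-- A field of matrices `(g i j)` is a Riemannian metric of class `C^n` on `U`, in coordinates. -/
structure IsRiemannianMetricOn (n : ℕ∞) (U : Set Plane)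
    (g : Plane → Matrix (Fin 2) (Fin 2) ℝ) : Prop where
  contDiffOn : ∀ i j, ContDiffOn ℝ (n : WithTop ℕ∞) (fun x => g x i j) U
  posDef : ∀ x ∈ U, (g x).PosDef

/-- The Christoffel symbol `Γ^k_{ij}` of `g`. -/
def christoffel (g : Plane → Matrix (Fin 2) (Fin 2) ℝ) (k i j : Fin 2) (x : Plane) : ℝ :=
  (1 / 2 : ℝ) * ∑ l : Fin 2, (g x)⁻¹ k l *
    (pd i (fun y => g y j l) x + pd j (fun y => g y i l) x - pd l (fun y => g y i j) x)

/-- The component `R^l` of `R(∂_i, ∂_j)∂_k = (∇_i ∇_j - ∇_j ∇_i) ∂_k = R^l ∂_l`. -/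
def riemann (g : Plane → Matrix (Fin 2) (Fin 2) ℝ) (l i j k : Fin 2) (x : Plane) : ℝ :=
  pd i (christoffel g l j k) x - pd j (christoffel g l i k) x +
    ∑ m : Fin 2, (christoffel g l i m x * christoffel g m j k x -
      christoffel g l j m x * christoffel g m i k x)

/-- The Gaussian curvature `K = g(R(∂_1, ∂_2)∂_2, ∂_1) / |g|`. -/
def gaussCurvature (g : Plane → Matrix (Fin 2) (Fin 2) ℝ) (x : Plane) : ℝ :=
  (∑ l : Fin 2, g x 0 l * riemann g l 0 1 1 x) / (g x).det

/-- The matrix of second covariant derivatives `∇_{ij} z = ∂_i ∂_j z - Γ^k_{ij} ∂_k z`. -/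
def covHessian (g : Plane → Matrix (Fin 2) (Fin 2) ℝ) (z : Plane → ℝ) (x : Plane) :
    Matrix (Fin 2) (Fin 2) ℝ :=
  Matrix.of fun i j => pd i (pd j z) x - ∑ k : Fin 2, christoffel g k i j x * pd k z x

/-- `|∇_g z|² = g^{ij} ∂_i z ∂_j z`. -/
def gradNormSq (g : Plane → Matrix (Fin 2) (Fin 2) ℝ) (z : Plane → ℝ) (x : Plane) : ℝ :=
  ∑ i : Fin 2, ∑ j : Fin 2, (g x)⁻¹ i j * pd i z x * pd j z x

/-- `z` satisfies the Darboux equation of `g` at every point of `U`. -/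
def SatisfiesDarbouxOn (g : Plane → Matrix (Fin 2) (Fin 2) ℝ) (U : Set Plane)
    (z : Plane → ℝ) : Prop :=
  ∀ x ∈ U, (covHessian g z x).det = gaussCurvature g x * (g x).det * (1 - gradNormSq g z x)

/-- The tensor `g - dz²`. -/
def subSq (g : Plane → Matrix (Fin 2) (Fin 2) ℝ) (z : Plane → ℝ) (x : Plane) :
    Matrix (Fin 2) (Fin 2) ℝ :=
  Matrix.of fun i j => g x i j - pd i z x * pd j z x

/-- The Riemann curvature tensor of a metric of class `C¹` vanishes on `U` in the sense of
distributions: the derivatives of the (continuous) Christoffel symbols are moved to the test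
function. -/
def IsWeaklyFlatOn (g : Plane → Matrix (Fin 2) (Fin 2) ℝ) (U : Set Plane) : Prop :=
  ∀ φ : Plane → ℝ, ContDiff ℝ ∞ φ → HasCompactSupport φ → tsupport φ ⊆ U →
    ∀ l i j k : Fin 2,
      ∫ x, (christoffel g l i k x * pd j φ x - christoffel g l j k x * pd i φ x +
        (∑ m : Fin 2, (christoffel g l i m x * christoffel g m j k x -
          christoffel g l j m x * christoffel g m i k x)) * φ x) = 0

/-- `F = (z₁, z₂, z₃)` is of class `C^n` on `V` with `g = dz₁² + dz₂² + dz₃²` there. -/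
structure IsIsometricImmersionOn (n : ℕ∞) (V : Set Plane)
    (g : Plane → Matrix (Fin 2) (Fin 2) ℝ) (F : Plane → Space) : Prop where
  contDiffOn : ContDiffOn ℝ (n : WithTop ℕ∞) F V
  isometric : ∀ x ∈ V, ∀ i j : Fin 2,
    ∑ α : Fin 3, pd i (fun y => F y α) x * pd j (fun y => F y α) x = g x i j

/-- An isometric immersion that is a homeomorphism of `V` onto its image. -/
structure IsIsometricEmbeddingOn (n : ℕ∞) (V : Set Plane)
    (g : Plane → Matrix (Fin 2) (Fin 2) ℝ) (F : Plane → Space) : Prop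
    extends IsIsometricImmersionOn n V g F where
  isEmbedding : Topology.IsEmbedding (V.domRestrict F)

end LocalSurface

end

/-! Darboux's equation says that `h = g - dz²` is flat. The matrix determinant lemma gives `|h| =
|g| (1 - |∇z|²)`, so `h` is a metric exactly when `|∇z| < 1`, and a direct computation gives `K_h
|h| = K |g| - det(∇_{ij} z) / (1 - |∇z|²)`. A flat metric is locally `dz₁² + dz₂²`, and `(z₁, z₂,
z)` is then isometric. In the other direction the equation for a component `z_α` follows from the
Gauss equation: with `N = ∂₀F × ∂₁F`, both `|g| ∇_{ij} z_α = N_α ⟨N, ∂_i∂_j F⟩` and `N_α² = |g| (1 -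
|∇z_α|²)` hold. The three numbers `|∇z_α|²` add up to `tr(g⁻¹ g) = 2`, so some component has
gradient shorter than 1.

The difficulty is regularity. For `n = 2` the metric `h` is only C¹ and its Christoffel symbols are
only continuous; likewise a C² map `F` has no third derivatives to commute. Curvature is therefore
handled through `HasWeakCurl`. For C¹ functions `f, v` the form `f dv` has weak curl `∂₁f ∂₀v - ∂₀f
∂₁v` (`HasWeakCurl.mul_pd`), which covers `∂_a F · d(∂_k F)` and `∂_a z d(∂_k z)` without third
derivatives. A continuous weak curl is unique (`HasWeakCurl.unique`), so it may be compared with the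
classical one where that exists.

Flat coordinates come from moving frames. For a Gram-Schmidt coframe of `h`, weak flatness makes the
connection form weakly closed; a weakly closed continuous form has a C¹ primitive `θ` locally
(`HasWeakCurl.exists_primitive`); rotating the coframe by `θ` makes it closed, and its primitives
are the coordinates (`exists_flat_coordinates`). -/

open scoped ContDiff

noncomputable section

namespace LocalSurface

open MeasureTheory Topology Set Metric

/-! ### Calculus of coordinate partial derivatives -/

section PartialDerivatives

variable {f u v : Plane → ℝ} {V : Set Plane} {x : Plane} {i j : Fin 2}

lemma pd_mul (hu : DifferentiableAt ℝ u x) (hv : DifferentiableAt ℝ v x) :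
    pd i (fun y => u y * v y) x = pd i u x * v x + u x * pd i v x := by
  simp only [pd]
  rw [fderiv_fun_mul hu hv]
  simp
  ring

lemma pd_add (hu : DifferentiableAt ℝ u x) (hv : DifferentiableAt ℝ v x) :
    pd i (fun y => u y + v y) x = pd i u x + pd i v x := by
  simp only [pd]
  rw [fderiv_fun_add hu hv]
  simp

lemma pd_sub (hu : DifferentiableAt ℝ u x) (hv : DifferentiableAt ℝ v x) :
    pd i (fun y => u y - v y) x = pd i u x - pd i v x := by
  simp only [pd]
  rw [fderiv_fun_sub hu hv]
  simp

lemma pd_const_mul (c : ℝ) (hv : DifferentiableAt ℝ v x) :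
    pd i (fun y => c * v y) x = c * pd i v x := by
  simp only [pd]
  rw [fderiv_const_mul hv]
  simp

lemma pd_sum {ι : Type*} (s : Finset ι) {w : ι → Plane → ℝ}
    (hw : ∀ a ∈ s, DifferentiableAt ℝ (w a) x) :
    pd i (fun y => ∑ a ∈ s, w a y) x = ∑ a ∈ s, pd i (w a) x := by
  simp only [pd]
  rw [fderiv_fun_sum hw]
  simp

lemma pd_congr_on (hV : IsOpen V) (h : ∀ y ∈ V, u y = v y) (hx : x ∈ V) :
    pd i u x = pd i v x := by
  simp only [pd]
  rw [Filter.EventuallyEq.fderiv_eq (Filter.eventually_of_mem (hV.mem_nhds hx) h)]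

lemma contDiffOn_pd {m n : WithTop ℕ∞} (hV : IsOpen V) (hu : ContDiffOn ℝ n u V)
    (hmn : m + 1 ≤ n) (i : Fin 2) : ContDiffOn ℝ m (pd i u) V :=
  (hu.fderiv_of_isOpen hV hmn).clm_apply contDiffOn_const

lemma continuousOn_pd (hV : IsOpen V) (hu : ContDiffOn ℝ 1 u V) (i : Fin 2) :
    ContinuousOn (pd i u) V :=
  (contDiffOn_pd (m := 0) hV hu (by simp) i).continuousOn

lemma pd_comm (hV : IsOpen V) (hu : ContDiffOn ℝ 2 u V) (hx : x ∈ V) (i j : Fin 2) :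
    pd i (pd j u) x = pd j (pd i u) x := by
  have h1 : ContDiffAt ℝ 2 u x := hu.contDiffAt (hV.mem_nhds hx)
  have h2 : IsSymmSndFDerivAt ℝ u x := h1.isSymmSndFDerivAt (by simp)
  have h3 : DifferentiableAt ℝ (fderiv ℝ u) x :=
    (h1.fderiv_right (m := 1) (by norm_num)).differentiableAt (by simp)
  have key : ∀ a b : Fin 2, pd a (pd b u) x =
      fderiv ℝ (fderiv ℝ u) x (EuclideanSpace.single a 1) (EuclideanSpace.single b 1) := by
    intro a b
    have : HasFDerivAt (fun y => fderiv ℝ u y (EuclideanSpace.single b 1)) _ x :=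
      h3.hasFDerivAt.clm_apply (hasFDerivAt_const (EuclideanSpace.single b 1) x)
    change fderiv ℝ (fun y => fderiv ℝ u y (EuclideanSpace.single b 1)) x _ = _
    rw [this.fderiv]
    simp
  rw [key, key, h2.eq]

lemma differentiableAt_of_contDiffOn (hV : IsOpen V) (hu : ContDiffOn ℝ 1 u V) (hx : x ∈ V) :
    DifferentiableAt ℝ u x :=
  (hu.contDiffAt (hV.mem_nhds hx)).differentiableAt (by simp)

end PartialDerivatives

/-! ### Localization by compactly supported functions -/

section Cutoff

variable {V : Set Plane} {u φ : Plane → ℝ}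

lemma continuous_mul_of_tsupport_subset (hV : IsOpen V) (hu : ContinuousOn u V)
    (hφ : Continuous φ) (hs : tsupport φ ⊆ V) : Continuous (fun x => u x * φ x) := by
  refine continuous_of_tsupport fun x hx => ?_
  have hx' : x ∈ V := hs (tsupport_mul_subset_right hx)
  exact (hu.continuousAt (hV.mem_nhds hx')).mul hφ.continuousAt

lemma contDiff_mul_of_tsupport_subset (hV : IsOpen V) (hu : ContDiffOn ℝ 1 u V)
    (hφ : ContDiff ℝ 1 φ) (hs : tsupport φ ⊆ V) : ContDiff ℝ 1 (fun x => u x * φ x) := by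
  rw [contDiff_iff_contDiffAt]
  intro x
  by_cases hx : x ∈ tsupport φ
  · exact (hu.contDiffAt (hV.mem_nhds (hs hx))).mul hφ.contDiffAt
  · have h0 : (fun x => u x * φ x) =ᶠ[𝓝 x] fun _ => 0 := by
      filter_upwards [notMem_tsupport_iff_eventuallyEq.mp hx] with y hy
      simp [hy]
    exact contDiffAt_const.congr_of_eventuallyEq h0

lemma integrable_mul_of_tsupport_subset (hV : IsOpen V) (hu : ContinuousOn u V)
    (hφ : Continuous φ) (hc : HasCompactSupport φ) (hs : tsupport φ ⊆ V) :
    Integrable (fun x => u x * φ x) :=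
  (continuous_mul_of_tsupport_subset hV hu hφ hs).integrable_of_hasCompactSupport hc.mul_left

lemma tsupport_pd_subset (i : Fin 2) : tsupport (pd i φ) ⊆ tsupport φ :=
  tsupport_fderiv_apply_subset ℝ _

lemma hasCompactSupport_pd (hc : HasCompactSupport φ) (i : Fin 2) : HasCompactSupport (pd i φ) :=
  hc.fderiv_apply ℝ _

lemma continuous_pd (hφ : ContDiff ℝ 1 φ) (i : Fin 2) : Continuous (pd i φ) :=
  (hφ.continuous_fderiv (by simp)).clm_apply continuous_const

/-- Equality with 1 near `K`, and not only on `K`, lets multiplication by `χ` preserve derivatives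
at points of `K`. -/
lemma exists_cutoff (hV : IsOpen V) {K : Set Plane} (hK : IsCompact K) (hKV : K ⊆ V) :
    ∃ χ : Plane → ℝ, ContDiff ℝ ∞ χ ∧ HasCompactSupport χ ∧ tsupport χ ⊆ V ∧
      ∀ᶠ x in 𝓝ˢ K, χ x = 1 := by
  obtain ⟨K', hK', h1, h2⟩ := exists_compact_between hK hV hKV
  obtain ⟨χ, hχ1, hχ0, -⟩ := exists_contMDiffMap_one_nhds_of_subset_interior
    (n := ⊤) (modelWithCornersSelf ℝ Plane) hK.isClosed h1
  have hsub : tsupport (χ : Plane → ℝ) ⊆ K' := by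
    refine closure_minimal (fun x hx => ?_) hK'.isClosed
    by_contra hxK
    exact hx (hχ0 x hxK)
  exact ⟨χ, χ.contMDiff.contDiff, hK'.of_isClosed_subset (isClosed_tsupport _) hsub,
    hsub.trans h2, hχ1⟩

end Cutoff

/-! ### Derivatives of convolutions -/

section Convolution

variable {f g : Plane → ℝ}

lemma pd_convolution_right (hf : Continuous f) (hg : ContDiff ℝ 1 g) (hgc : HasCompactSupport g)
    (i : Fin 2) (x : Plane) :
    pd i (convolution f g (ContinuousLinearMap.mul ℝ ℝ) volume) x =
      convolution f (pd i g) (ContinuousLinearMap.mul ℝ ℝ) volume x := by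
  have h := hgc.hasFDerivAt_convolution_right (μ := volume) (ContinuousLinearMap.mul ℝ ℝ)
    hf.locallyIntegrable hg x
  rw [pd, h.fderiv, convolution_precompR_apply _ hf.locallyIntegrable (hgc.fderiv ℝ)
    (hg.continuous_fderiv (by simp))]
  rfl

lemma pd_convolution_left (hf : ContDiff ℝ 1 f) (hfc : HasCompactSupport f) (hg : Continuous g)
    (i : Fin 2) (x : Plane) :
    pd i (convolution f g (ContinuousLinearMap.mul ℝ ℝ) volume) x =
      convolution (pd i f) g (ContinuousLinearMap.mul ℝ ℝ) volume x := by
  have hL : (ContinuousLinearMap.mul ℝ ℝ).flip = ContinuousLinearMap.mul ℝ ℝ := by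
    ext; simp
  have hcomm : ∀ u v : Plane → ℝ, convolution u v (ContinuousLinearMap.mul ℝ ℝ) volume =
      convolution v u (ContinuousLinearMap.mul ℝ ℝ) volume := by
    intro u v
    conv_lhs => rw [← hL, convolution_flip]
  rw [hcomm f g, hcomm (pd i f) g]
  exact pd_convolution_right hg hf hfc i x

/-- One derivative falls on each factor, so two C¹ functions suffice. -/
lemma contDiff_two_convolution (hf : ContDiff ℝ 1 f) (hg : ContDiff ℝ 1 g)
    (hfc : HasCompactSupport f) (hgc : HasCompactSupport g) :
    ContDiff ℝ 2 (convolution f g (ContinuousLinearMap.mul ℝ ℝ) volume) := by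
  have h := fun x => hgc.hasFDerivAt_convolution_right (μ := volume)
    (ContinuousLinearMap.mul ℝ ℝ) hf.continuous.locallyIntegrable hg x
  rw [show (2 : WithTop ℕ∞) = 1 + 1 by norm_num, contDiff_succ_iff_fderiv]
  refine ⟨fun x => (h x).differentiableAt, by simp, ?_⟩
  rw [funext fun x => (h x).fderiv]
  exact hfc.contDiff_convolution_left (n := 1) _ hf
    (hg.continuous_fderiv (by simp)).locallyIntegrable

end Convolution

/-- Integrating by parts twice would need second derivatives. Instead, both sides are, up to sign,
mixed second derivatives at the origin of the convolution of `φ` with the reflection of `u`, which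
is C², so Schwarz's theorem applies. -/
lemma integral_pd_mul_pd_comm {φ u : Plane → ℝ} (hφ : ContDiff ℝ 1 φ) (hu : ContDiff ℝ 1 u)
    (hφc : HasCompactSupport φ) (huc : HasCompactSupport u) (i j : Fin 2) :
    ∫ x, pd i φ x * pd j u x = ∫ x, pd j φ x * pd i u x := by
  set g : Plane → ℝ := fun x => u (-x) with hg
  have hgs : ContDiff ℝ 1 g := hu.comp contDiff_neg
  have hgc : HasCompactSupport g := huc.comp_homeomorph (Homeomorph.neg Plane)
  have hpg : ∀ k x, pd k g (-x) = - pd k u x := by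
    intro k x
    have hx : HasFDerivAt u (fderiv ℝ u x) (- -x) := by
      simpa using (hu.differentiable (by simp) x).hasFDerivAt
    have h5 : HasFDerivAt g _ (-x) := hx.comp (-x) (hasFDerivAt_id (-x)).neg
    rw [pd, h5.fderiv]
    simp [pd]
  have key : ∀ a b : Fin 2, pd a (pd b (convolution φ g (ContinuousLinearMap.mul ℝ ℝ) volume)) 0
      = - ∫ x, pd a φ x * pd b u x := by
    intro a b
    rw [show pd b (convolution φ g (ContinuousLinearMap.mul ℝ ℝ) volume) = _ from
      funext fun x => pd_convolution_right hφ.continuous hgs hgc b x,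
      pd_convolution_left hφ hφc (continuous_pd hgs b), convolution_def, ← integral_neg]
    simp [hpg]
  have := pd_comm isOpen_univ (contDiff_two_convolution hφ hgs hφc hgc).contDiffOn
    (mem_univ 0) i j
  rw [key, key] at this
  exact neg_injective this

/-! ### Weak curl of continuous one-forms -/

section

/-- The continuous one-form `A dx⁰ + B dx¹` satisfies `∂₁A - ∂₀B = C` on `V` in the weak sense,
tested against compactly supported functions of class `C¹`. -/
structure HasWeakCurl (V : Set Plane) (A B C : Plane → ℝ) : Prop where
  left : ContinuousOn A V
  right : ContinuousOn B V
  curl : ContinuousOn C V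
  integral_eq_zero : ∀ φ : Plane → ℝ, ContDiff ℝ 1 φ → HasCompactSupport φ → tsupport φ ⊆ V →
    ∫ x, (A x * pd 1 φ x - B x * pd 0 φ x + C x * φ x) = 0

namespace HasWeakCurl

variable {V : Set Plane} {A B C A' B' C' f v φ : Plane → ℝ}

lemma integral_split (hV : IsOpen V) (hA : ContinuousOn A V) (hB : ContinuousOn B V)
    (hC : ContinuousOn C V) (hφ : ContDiff ℝ 1 φ) (hc : HasCompactSupport φ)
    (hs : tsupport φ ⊆ V) :
    Integrable (fun x => A x * pd 1 φ x) ∧ Integrable (fun x => B x * pd 0 φ x) ∧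
      Integrable (fun x => C x * φ x) ∧
    ∫ x, (A x * pd 1 φ x - B x * pd 0 φ x + C x * φ x) =
      (∫ x, A x * pd 1 φ x) - (∫ x, B x * pd 0 φ x) + ∫ x, C x * φ x := by
  have h1 : Integrable (fun x => A x * pd 1 φ x) := integrable_mul_of_tsupport_subset hV hA
    (continuous_pd hφ 1) (hasCompactSupport_pd hc 1) ((tsupport_pd_subset 1).trans hs)
  have h2 : Integrable (fun x => B x * pd 0 φ x) := integrable_mul_of_tsupport_subset hV hB
    (continuous_pd hφ 0) (hasCompactSupport_pd hc 0) ((tsupport_pd_subset 0).trans hs)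
  have h3 : Integrable (fun x => C x * φ x) := integrable_mul_of_tsupport_subset hV hC
    hφ.continuous hc hs
  refine ⟨h1, h2, h3, ?_⟩
  have e := integral_add (h1.sub h2) h3
  simp only [Pi.sub_apply] at e
  rw [e, integral_sub h1 h2]

lemma congr (h : HasWeakCurl V A B C) (hA : ∀ x ∈ V, A' x = A x) (hB : ∀ x ∈ V, B' x = B x)
    (hC : ∀ x ∈ V, C' x = C x) : HasWeakCurl V A' B' C' := by
  refine ⟨h.left.congr hA, h.right.congr hB, h.curl.congr hC, fun φ hφ hc hs => ?_⟩
  rw [← h.integral_eq_zero φ hφ hc hs]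
  congr 1
  ext x
  by_cases hx : x ∈ V
  · rw [hA x hx, hB x hx, hC x hx]
  · have h0 : ∀ ψ : Plane → ℝ, tsupport ψ ⊆ tsupport φ → ψ x = 0 := fun ψ hψ =>
      image_eq_zero_of_notMem_tsupport fun hx' => hx (hs (hψ hx'))
    simp [h0 φ subset_rfl, h0 _ (tsupport_pd_subset 0), h0 _ (tsupport_pd_subset 1)]

lemma mono {W : Set Plane} (h : HasWeakCurl V A B C) (hWV : W ⊆ V) : HasWeakCurl W A B C :=
  ⟨h.left.mono hWV, h.right.mono hWV, h.curl.mono hWV,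
    fun φ hφ hc hs => h.integral_eq_zero φ hφ hc (hs.trans hWV)⟩

lemma add (hV : IsOpen V) (h : HasWeakCurl V A B C) (h' : HasWeakCurl V A' B' C') :
    HasWeakCurl V (fun x => A x + A' x) (fun x => B x + B' x) (fun x => C x + C' x) := by
  refine ⟨h.left.add h'.left, h.right.add h'.right, h.curl.add h'.curl, fun φ hφ hc hs => ?_⟩
  obtain ⟨h1, h2, h3, -⟩ := integral_split hV h.left h.right h.curl hφ hc hs
  obtain ⟨h1', h2', h3', -⟩ := integral_split hV h'.left h'.right h'.curl hφ hc hs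
  have e := h.integral_eq_zero φ hφ hc hs
  have e' := h'.integral_eq_zero φ hφ hc hs
  have := integral_add ((h1.sub h2).add h3) ((h1'.sub h2').add h3')
  simp only [Pi.add_apply, Pi.sub_apply] at this
  rw [e, e', add_zero] at this
  rw [← this]
  congr 1
  ext x
  ring

lemma zero : HasWeakCurl V (fun _ => 0) (fun _ => 0) (fun _ => 0) :=
  ⟨continuousOn_const, continuousOn_const, continuousOn_const, fun _ _ _ _ => by simp⟩

lemma sum {ι : Type*} (hV : IsOpen V) (s : Finset ι) {a b c : ι → Plane → ℝ}
    (h : ∀ k ∈ s, HasWeakCurl V (a k) (b k) (c k)) :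
    HasWeakCurl V (fun x => ∑ k ∈ s, a k x) (fun x => ∑ k ∈ s, b k x)
      (fun x => ∑ k ∈ s, c k x) := by
  classical
  induction s using Finset.induction_on with
  | empty => simpa using zero
  | insert k s hk ih =>
    simp only [Finset.sum_insert hk]
    exact (h k (by simp)).add hV (ih fun l hl => h l (by simp [hl]))

/-- The factor `f` is absorbed into the test function. The product `f φ` is only C¹, which is why
the definition tests against C¹ functions. -/
lemma mul (hV : IsOpen V) (h : HasWeakCurl V A B C) (hf : ContDiffOn ℝ 1 f V) :
    HasWeakCurl V (fun x => f x * A x) (fun x => f x * B x)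
      (fun x => f x * C x + pd 1 f x * A x - pd 0 f x * B x) := by
  have hf0 := hf.continuousOn
  refine ⟨hf0.mul h.left, hf0.mul h.right, ((hf0.mul h.curl).add
    ((continuousOn_pd hV hf 1).mul h.left)).sub ((continuousOn_pd hV hf 0).mul h.right),
    fun φ hφ hc hs => ?_⟩
  have hs' : tsupport (fun x => f x * φ x) ⊆ V := (tsupport_mul_subset_right).trans hs
  rw [← h.integral_eq_zero (fun x => f x * φ x)
    (contDiff_mul_of_tsupport_subset hV hf hφ hs) hc.mul_left hs']
  congr 1
  ext x
  by_cases hx : x ∈ V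
  · have hd := differentiableAt_of_contDiffOn hV hf hx
    have hd' := hφ.differentiable (by simp) x
    rw [pd_mul hd hd', pd_mul hd hd']
    ring
  · have h0 : ∀ ψ : Plane → ℝ, tsupport ψ ⊆ V → ψ x = 0 := fun ψ hψ =>
      image_eq_zero_of_notMem_tsupport fun hx' => hx (hψ hx')
    simp [h0 φ hs, h0 _ ((tsupport_pd_subset 0).trans hs), h0 _ ((tsupport_pd_subset 1).trans hs),
      h0 _ ((tsupport_pd_subset 0).trans hs'), h0 _ ((tsupport_pd_subset 1).trans hs')]

lemma integral_mul_pd (hV : IsOpen V) (hA : ContDiffOn ℝ 1 A V) (hφ : ContDiff ℝ 1 φ)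
    (hc : HasCompactSupport φ) (hs : tsupport φ ⊆ V) (i : Fin 2) :
    ∫ x, A x * pd i φ x = - ∫ x, pd i A x * φ x := by
  have hA0 := hA.continuousOn
  refine integral_mul_fderiv_eq_neg_fderiv_mul_of_integrable ?_ ?_ ?_ ?_ ?_
  · exact integrable_mul_of_tsupport_subset hV (continuousOn_pd hV hA i) hφ.continuous hc hs
  · exact integrable_mul_of_tsupport_subset hV hA0 (continuous_pd hφ i)
      (hasCompactSupport_pd hc i) ((tsupport_pd_subset i).trans hs)
  · exact integrable_mul_of_tsupport_subset hV hA0 hφ.continuous hc hs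
  · exact fun x hx => differentiableAt_of_contDiffOn hV hA (hs hx)
  · exact fun x _ => hφ.differentiable (by simp) x

lemma of_contDiffOn (hV : IsOpen V) (hA : ContDiffOn ℝ 1 A V) (hB : ContDiffOn ℝ 1 B V) :
    HasWeakCurl V A B (fun x => pd 1 A x - pd 0 B x) := by
  have hC : ContinuousOn (fun x => pd 1 A x - pd 0 B x) V :=
    (continuousOn_pd hV hA 1).sub (continuousOn_pd hV hB 0)
  refine ⟨hA.continuousOn, hB.continuousOn, hC, fun φ hφ hc hs => ?_⟩
  obtain ⟨-, -, -, h⟩ := integral_split hV hA.continuousOn hB.continuousOn hC hφ hc hs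
  rw [h, integral_mul_pd hV hA hφ hc hs, integral_mul_pd hV hB hφ hc hs]
  simp only [sub_mul]
  rw [integral_sub (integrable_mul_of_tsupport_subset hV (continuousOn_pd hV hA 1)
    hφ.continuous hc hs) (integrable_mul_of_tsupport_subset hV (continuousOn_pd hV hB 0)
    hφ.continuous hc hs)]
  ring

/-- This is `d(dv) = 0` for `v` merely C¹: after a cutoff it is the symmetry in
`integral_pd_mul_pd_comm`. -/
lemma of_pd (hV : IsOpen V) (hv : ContDiffOn ℝ 1 v V) :
    HasWeakCurl V (pd 0 v) (pd 1 v) (fun _ => 0) := by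
  refine ⟨continuousOn_pd hV hv 0, continuousOn_pd hV hv 1, continuousOn_const,
    fun φ hφ hc hs => ?_⟩
  obtain ⟨-, -, -, h⟩ := integral_split hV (continuousOn_pd hV hv 0) (continuousOn_pd hV hv 1)
    (continuousOn_const (c := (0 : ℝ))) hφ hc hs
  obtain ⟨χ, hχ, hχc, hχs, hχ1⟩ := exists_cutoff hV hc.isCompact hs
  have hχ' : ContDiff ℝ 1 χ := hχ.of_le (by exact_mod_cast le_top)
  set u : Plane → ℝ := fun x => v x * χ x
  have hu : ContDiff ℝ 1 u := contDiff_mul_of_tsupport_subset hV hv hχ' hχs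
  -- In `Fin 2` the index `1 - i` is the other coordinate.
  have huv : ∀ i x, pd i v x * pd (1 - i) φ x = pd (1 - i) φ x * pd i u x := by
    intro i x
    by_cases hx : x ∈ tsupport φ
    · have : u =ᶠ[𝓝 x] v := by
        filter_upwards [hχ1.filter_mono (nhds_le_nhdsSet hx)] with y hy
        simp [u, hy]
      simp only [pd, this.fderiv_eq]
      ring
    · have : pd (1 - i) φ x = 0 :=
        image_eq_zero_of_notMem_tsupport fun hx' => hx (tsupport_pd_subset _ hx')
      simp [this]
  have key := integral_pd_mul_pd_comm hφ hu hc hχc.mul_left 1 0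
  have e0 := fun x => huv 0 x
  have e1 := fun x => huv 1 x
  simp only [sub_zero, sub_self] at e0 e1
  rw [h]
  simp only [e0, e1, key]
  simp

lemma mul_pd (hV : IsOpen V) (hf : ContDiffOn ℝ 1 f V) (hv : ContDiffOn ℝ 1 v V) :
    HasWeakCurl V (fun x => f x * pd 0 v x) (fun x => f x * pd 1 v x)
      (fun x => pd 1 f x * pd 0 v x - pd 0 f x * pd 1 v x) :=
  ((of_pd hV hv).mul hV hf).congr (fun _ _ => rfl) (fun _ _ => rfl) (fun _ _ => by ring)

/-- The fundamental lemma of the calculus of variations gives equality almost everywhere, and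
continuity gives it everywhere. -/
lemma unique (hV : IsOpen V) (h : HasWeakCurl V A B C) (h' : HasWeakCurl V A B C') :
    ∀ x ∈ V, C x = C' x := by
  have hd : ContinuousOn (fun x => C x - C' x) V := h.curl.sub h'.curl
  have hae : ∀ᵐ x : Plane, x ∈ V → C x - C' x = 0 := by
    refine hV.ae_eq_zero_of_integral_contDiff_smul_eq_zero
      (hd.locallyIntegrableOn hV.measurableSet) fun φ hφ hc hs => ?_
    have hφ1 : ContDiff ℝ 1 φ := hφ.of_le (by exact_mod_cast le_top)
    obtain ⟨-, -, h3, e⟩ := integral_split hV h.left h.right h.curl hφ1 hc hs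
    obtain ⟨-, -, h3', e'⟩ := integral_split hV h'.left h'.right h'.curl hφ1 hc hs
    rw [h.integral_eq_zero φ hφ1 hc hs] at e
    rw [h'.integral_eq_zero φ hφ1 hc hs] at e'
    have : ∀ x, φ x • (C x - C' x) = C x * φ x - C' x * φ x := fun x => by
      rw [smul_eq_mul]; ring
    simp only [this]
    rw [integral_sub h3 h3']
    linarith
  have := Measure.eqOn_open_of_ae_eq (μ := volume) (f := fun x => C x - C' x) (g := fun _ => 0)
    ((ae_restrict_iff' hV.measurableSet).mpr hae) hV hd continuousOn_const
  exact fun x hx => sub_eq_zero.mp (this hx)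

end HasWeakCurl

end

/-! ### Primitives of weakly closed one-forms -/

section

/-- The one-form `a dx⁰ + b dx¹` with constant coefficients. -/
def oneForm (a b : ℝ) : Plane →L[ℝ] ℝ :=
  a • (EuclideanSpace.proj 0 : Plane →L[ℝ] ℝ) + b • (EuclideanSpace.proj 1 : Plane →L[ℝ] ℝ)

@[simp] lemma oneForm_apply (a b : ℝ) (v : Plane) : oneForm a b v = a * v 0 + b * v 1 := by
  simp [oneForm]

lemma apply_eq_sum (T : Plane →L[ℝ] ℝ) (v : Plane) :
    T v = T (EuclideanSpace.single 0 1) * v 0 + T (EuclideanSpace.single 1 1) * v 1 := by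
  have hv : v = v 0 • EuclideanSpace.single 0 (1 : ℝ) + v 1 • EuclideanSpace.single 1 (1 : ℝ) := by
    ext i
    fin_cases i <;> simp
  conv_lhs => rw [hv]
  rw [map_add, map_smul, map_smul]
  simp only [smul_eq_mul]
  ring

lemma fderiv_eq_oneForm (u : Plane → ℝ) (x : Plane) :
    fderiv ℝ u x = oneForm (pd 0 u x) (pd 1 u x) := by
  ext v
  rw [apply_eq_sum, oneForm_apply]
  rfl

lemma pd_eq_of_hasFDerivAt_oneForm {u : Plane → ℝ} {a b : ℝ} {x : Plane}
    (h : HasFDerivAt u (oneForm a b) x) : pd 0 u x = a ∧ pd 1 u x = b := by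
  simp [pd, h.fderiv]

lemma exists_primitive_of_contDiff {a b : Plane → ℝ} {s : Set Plane} (hs : Convex ℝ s)
    (hso : IsOpen s) (ha : ContDiffOn ℝ 1 a s) (hb : ContDiffOn ℝ 1 b s)
    (hab : ∀ x ∈ s, pd 1 a x = pd 0 b x) :
    ∃ θ : Plane → ℝ, ∀ x ∈ s, HasFDerivAt θ (oneForm (a x) (b x)) x := by
  have hd : ∀ x ∈ s, HasFDerivAt (fun y => oneForm (a y) (b y))
      ((fderiv ℝ a x).smulRight (EuclideanSpace.proj 0 : Plane →L[ℝ] ℝ) +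
        (fderiv ℝ b x).smulRight (EuclideanSpace.proj 1 : Plane →L[ℝ] ℝ)) x := fun x hx =>
    HasFDerivAt.add
      ((differentiableAt_of_contDiffOn hso ha hx).hasFDerivAt.smul_const
        (EuclideanSpace.proj 0 : Plane →L[ℝ] ℝ))
      ((differentiableAt_of_contDiffOn hso hb hx).hasFDerivAt.smul_const
        (EuclideanSpace.proj 1 : Plane →L[ℝ] ℝ))
  refine hs.exists_forall_hasFDerivAt_of_fderiv_symmetric hso
    (fun x hx => (hd x hx).differentiableAt.differentiableWithinAt) fun x hx v w => ?_
  rw [(hd x hx).fderiv]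
  simp [fderiv_eq_oneForm, hab x hx]
  ring

namespace HasWeakCurl

/-- Mollification preserves closedness: the identity at `x` is weak closedness tested against `y ↦ ρ
(x - y)`, whose support must lie in `W`. -/
lemma pd_convolution_comm {W : Set Plane} {a b ρ : Plane → ℝ} {x : Plane}
    (h : HasWeakCurl W a b (fun _ => 0)) (ha : Continuous a)
    (hb : Continuous b) (hρ : ContDiff ℝ 1 ρ) (hρc : HasCompactSupport ρ)
    (hx : ∀ t ∈ tsupport ρ, x - t ∈ W) :
    pd 1 (convolution ρ a (ContinuousLinearMap.mul ℝ ℝ) volume) x =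
      pd 0 (convolution ρ b (ContinuousLinearMap.mul ℝ ℝ) volume) x := by
  set e : Plane ≃ₜ Plane := Homeomorph.subLeft x
  set φ : Plane → ℝ := fun y => ρ (x - y) with hφ
  have hφd : ContDiff ℝ 1 φ := hρ.comp (contDiff_const.sub contDiff_id)
  have hφc : HasCompactSupport φ := hρc.comp_homeomorph e
  have hφs : tsupport φ ⊆ W := by
    intro y hy
    have hy' : e y ∈ tsupport ρ := by
      have := tsupport_comp_eq_preimage ρ e
      rw [show φ = ρ ∘ e from rfl, this] at hy
      exact hy
    simpa [e] using hx _ hy'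
  have hpd : ∀ i y, pd i φ y = - pd i ρ (x - y) := by
    intro i y
    have h1 : HasFDerivAt φ _ y := (hρ.differentiable (by simp) (x - y)).hasFDerivAt.comp y
      ((hasFDerivAt_id y).const_sub x)
    rw [pd, h1.fderiv]
    simp [pd]
  have key : ∀ (c : Plane → ℝ), Continuous c → ∀ i,
      pd i (convolution ρ c (ContinuousLinearMap.mul ℝ ℝ) volume) x =
        - ∫ y, c y * pd i φ y := by
    intro c hc i
    rw [pd_convolution_left hρ hρc hc, convolution_eq_swap, ← integral_neg]
    congr 1
    ext y
    simp [hpd]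
    ring
  have hint : ∀ (c : Plane → ℝ), Continuous c → ∀ i, Integrable (fun y => c y * pd i φ y) :=
    fun c hc i => (hc.mul (continuous_pd hφd i)).integrable_of_hasCompactSupport
      (hasCompactSupport_pd hφc i).mul_left
  have e0 := h.integral_eq_zero φ hφd hφc hφs
  simp only [zero_mul, add_zero] at e0
  rw [integral_sub (hint a ha 1) (hint b hb 0)] at e0
  rw [key a ha, key b hb]
  linarith

variable {V : Set Plane} {A B : Plane → ℝ}

/-- Mollified forms are closed and C¹, hence have primitives by the Poincaré lemma. They converge
uniformly, so the primitives converge to a function with the limit form as differential. -/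
lemma exists_primitive (hV : IsOpen V) (h : HasWeakCurl V A B (fun _ => 0)) {p : Plane}
    (hp : p ∈ V) : ∃ r > 0, ball p r ⊆ V ∧ ∃ θ : Plane → ℝ, ∀ x ∈ ball p r,
      HasFDerivAt θ (oneForm (A x) (B x)) x := by
  obtain ⟨s, hs, hsV⟩ := Metric.isOpen_iff.mp hV p hp
  -- The ball of radius `2 * r` leaves room for mollifiers of radius at most `r` at points of `ball
  -- p r`, with its closure still inside `V`.
  set r := s / 3 with hr
  have hr0 : 0 < r := by positivity
  have hKV : closedBall p (2 * r) ⊆ V := (closedBall_subset_ball (by linarith)).trans hsV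
  obtain ⟨χ, hχ, hχc, hχs, hχ1⟩ := exists_cutoff hV (isCompact_closedBall p (2 * r)) hKV
  have hχ1' : ∀ x ∈ ball p (2 * r), χ x = 1 := fun x hx =>
    hχ1.self_of_nhdsSet x (ball_subset_closedBall hx)
  set a : Plane → ℝ := fun x => A x * χ x with ha
  set b : Plane → ℝ := fun x => B x * χ x with hb
  have hac : Continuous a := continuous_mul_of_tsupport_subset hV h.left hχ.continuous hχs
  have hbc : Continuous b := continuous_mul_of_tsupport_subset hV h.right hχ.continuous hχs
  have hau : UniformContinuous a := hχc.mul_left.uniformContinuous_of_continuous hac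
  have hbu : UniformContinuous b := hχc.mul_left.uniformContinuous_of_continuous hbc
  have hW : HasWeakCurl (ball p (2 * r)) a b (fun _ => 0) :=
    (h.mono (ball_subset_closedBall.trans hKV)).congr (fun x hx => by simp [ha, hχ1' x hx])
      (fun x hx => by simp [hb, hχ1' x hx]) (fun _ _ => rfl)
  have hball : ball p r ⊆ ball p (2 * r) := ball_subset_ball (by linarith)
  have step : ∀ n : ℕ, ∃ (an bn θ : Plane → ℝ), θ p = 0 ∧ ∀ x ∈ ball p r,
      HasFDerivAt θ (oneForm (an x) (bn x)) x ∧ |an x - a x| ≤ 1 / (n + 1 : ℝ) ∧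
        |bn x - b x| ≤ 1 / (n + 1 : ℝ) := by
    intro n
    have hε : (0 : ℝ) < 1 / (n + 1 : ℝ) := by positivity
    obtain ⟨δ1, hδ1, h1⟩ := Metric.uniformContinuous_iff.mp hau _ hε
    obtain ⟨δ2, hδ2, h2⟩ := Metric.uniformContinuous_iff.mp hbu _ hε
    set δ := min r (min δ1 δ2)
    have hδ : 0 < δ := lt_min hr0 (lt_min hδ1 hδ2)
    set φ : ContDiffBump (0 : Plane) := ⟨δ / 2, δ, half_pos hδ, half_lt_self hδ⟩
    set ρ : Plane → ℝ := φ.normed volume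
    have hρ : ContDiff ℝ ∞ ρ := φ.contDiff_normed
    have hρ1 : ContDiff ℝ 1 ρ := hρ.of_le (by exact_mod_cast le_top)
    have hρc : HasCompactSupport ρ := φ.hasCompactSupport_normed
    have hC : ∀ c : Plane → ℝ, Continuous c → ContDiff ℝ 1
        (convolution ρ c (ContinuousLinearMap.mul ℝ ℝ) volume) := fun c hc =>
      hρc.contDiff_convolution_left (n := 1) _ hρ1 hc.locallyIntegrable
    have hsymm : ∀ x ∈ ball p r, pd 1 (convolution ρ a (ContinuousLinearMap.mul ℝ ℝ) volume) x =
        pd 0 (convolution ρ b (ContinuousLinearMap.mul ℝ ℝ) volume) x := by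
      intro x hx
      refine hW.pd_convolution_comm hac hbc hρ1 hρc fun t ht => ?_
      rw [φ.tsupport_normed_eq] at ht
      have h3 : ‖t‖ ≤ r := (mem_closedBall_zero_iff.mp ht).trans (min_le_left _ _)
      have h4 : ‖x - p‖ < r := mem_ball_iff_norm.mp hx
      rw [mem_ball_iff_norm]
      calc ‖x - t - p‖ = ‖(x - p) - t‖ := by congr 1; abel
        _ ≤ ‖x - p‖ + ‖t‖ := norm_sub_le _ _
        _ < 2 * r := by linarith
    obtain ⟨θ, hθ⟩ := exists_primitive_of_contDiff (convex_ball p r) isOpen_ball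
      (hC a hac).contDiffOn (hC b hbc).contDiffOn hsymm
    -- Normalizing the primitives to vanish at `p` gives convergence at one point; uniform
    -- convergence of the differentials then carries it to the whole ball.
    refine ⟨_, _, fun x => θ x - θ p, sub_self _, fun x hx =>
      ⟨(hθ x hx).sub_const _, ?_, ?_⟩⟩
    · exact φ.dist_normed_convolution_le hac.aestronglyMeasurable fun y hy =>
        (h1 (hy.trans_le ((min_le_right _ _).trans (min_le_left _ _)))).le
    · exact φ.dist_normed_convolution_le hbc.aestronglyMeasurable fun y hy =>
        (h2 (hy.trans_le ((min_le_right _ _).trans (min_le_right _ _)))).le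
  choose an bn θn hθp hn using step
  have hunif : TendstoUniformlyOn (fun n x => oneForm (an n x) (bn n x))
      (fun x => oneForm (a x) (b x)) Filter.atTop (ball p r) := by
    rw [Metric.tendstoUniformlyOn_iff]
    intro ε hε
    set P := ‖(EuclideanSpace.proj 0 : Plane →L[ℝ] ℝ)‖ + ‖(EuclideanSpace.proj 1 : Plane →L[ℝ] ℝ)‖
    have hlim : Filter.Tendsto (fun n : ℕ => 1 / (n + 1 : ℝ) * P) Filter.atTop (𝓝 0) := by
      simpa using tendsto_one_div_add_atTop_nhds_zero_nat.mul_const P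
    filter_upwards [hlim.eventually_lt_const hε] with n hnε x hx
    obtain ⟨-, h1, h2⟩ := hn n x hx
    refine lt_of_le_of_lt ?_ hnε
    rw [dist_comm, dist_eq_norm]
    have : oneForm (an n x) (bn n x) - oneForm (a x) (b x) =
        (an n x - a x) • (EuclideanSpace.proj 0 : Plane →L[ℝ] ℝ) +
          (bn n x - b x) • (EuclideanSpace.proj 1 : Plane →L[ℝ] ℝ) := by
      simp only [oneForm, sub_smul]
      abel
    rw [this, mul_add]
    refine (norm_add_le _ _).trans (add_le_add ?_ ?_)
    · rw [norm_smul]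
      exact mul_le_mul_of_nonneg_right h1 (norm_nonneg _)
    · rw [norm_smul]
      exact mul_le_mul_of_nonneg_right h2 (norm_nonneg _)
  have hcau : UniformCauchySeqOn θn Filter.atTop (ball p r) := by
    refine uniformCauchySeqOn_ball_of_fderiv hunif.uniformCauchySeqOn
      (fun n x hx => (hn n x hx).1) ?_
    simp only [hθp]
    exact tendsto_const_nhds.cauchy_map
  have hlim : ∀ x, ∃ y, x ∈ ball p r → Filter.Tendsto (fun n => θn n x) Filter.atTop (𝓝 y) := by
    intro x
    by_cases hx : x ∈ ball p r
    · obtain ⟨y, hy⟩ := cauchySeq_tendsto_of_complete (hcau.cauchySeq hx)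
      exact ⟨y, fun _ => hy⟩
    · exact ⟨0, fun h => absurd h hx⟩
  choose θ hθ using hlim
  refine ⟨r, hr0, hball.trans (ball_subset_closedBall.trans hKV), θ, fun x hx => ?_⟩
  have := hasFDerivAt_of_tendstoUniformlyOn isOpen_ball hunif (fun n x hx => (hn n x hx).1) hθ hx
  simpa [ha, hb, hχ1' x (hball hx)] using this

end HasWeakCurl

lemma contDiffOn_of_pd {W : Set Plane} (hW : IsOpen W) {m : ℕ} {u : Plane → ℝ}
    (hu : ∀ x ∈ W, DifferentiableAt ℝ u x) (h : ∀ i, ContDiffOn ℝ m (pd i u) W) :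
    ContDiffOn ℝ (m + 1) u W := by
  rw [contDiffOn_succ_iff_fderiv_of_isOpen hW]
  refine ⟨fun x hx => (hu x hx).differentiableWithinAt, by simp, ?_⟩
  have : fderiv ℝ u = fun x => oneForm (pd 0 u x) (pd 1 u x) := funext (fderiv_eq_oneForm u)
  rw [this]
  exact ((h 0).smul contDiffOn_const).add ((h 1).smul contDiffOn_const)

end

/-! ### Christoffel symbols and curvature through weak curls -/

section

/-- The Christoffel symbol of the first kind `Γ_{l,ik}` of `g`. -/
def christoffelLow (g : Plane → Matrix (Fin 2) (Fin 2) ℝ) (l i k : Fin 2) (x : Plane) : ℝ :=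
  (1 / 2 : ℝ) * (pd i (fun y => g y k l) x + pd k (fun y => g y i l) x -
    pd l (fun y => g y i k) x)

/-- The quadratic part `Γ_{b,1a} Γ^b_{0k} - Γ_{b,0a} Γ^b_{1k}` of the lowered curvature. -/
def lowQuadratic (g : Plane → Matrix (Fin 2) (Fin 2) ℝ) (a k : Fin 2) (x : Plane) : ℝ :=
  ∑ b : Fin 2, (christoffelLow g b 1 a x * christoffel g b 0 k x -
    christoffelLow g b 0 a x * christoffel g b 1 k x)

variable {V W : Set Plane} {g : Plane → Matrix (Fin 2) (Fin 2) ℝ} {x : Plane}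

lemma christoffel_eq_sum (g : Plane → Matrix (Fin 2) (Fin 2) ℝ) (m i k : Fin 2) (x : Plane) :
    christoffel g m i k x = ∑ l : Fin 2, (g x)⁻¹ m l * christoffelLow g l i k x := by
  simp only [christoffel, christoffelLow, Fin.sum_univ_two]
  ring

namespace IsRiemannianMetricOn

lemma of_le {m n : ℕ∞} (hg : IsRiemannianMetricOn n V g) (hmn : m ≤ n) :
    IsRiemannianMetricOn m V g :=
  ⟨fun i j => (hg.contDiffOn i j).of_le (by exact_mod_cast hmn), hg.posDef⟩

lemma mono {n : ℕ∞} (hg : IsRiemannianMetricOn n V g) (hW : W ⊆ V) :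
    IsRiemannianMetricOn n W g :=
  ⟨fun i j => (hg.contDiffOn i j).mono hW, fun x hx => hg.posDef x (hW hx)⟩

lemma symm {n : ℕ∞} (hg : IsRiemannianMetricOn n V g) (hx : x ∈ V) (i j : Fin 2) :
    g x i j = g x j i := by
  simpa using (hg.posDef x hx).isHermitian.apply j i

lemma det_pos {n : ℕ∞} (hg : IsRiemannianMetricOn n V g) (hx : x ∈ V) : 0 < (g x).det :=
  (hg.posDef x hx).det_pos

lemma contDiffOn_one (hg : IsRiemannianMetricOn 1 V g) (i j : Fin 2) :
    ContDiffOn ℝ 1 (fun x => g x i j) V := by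
  simpa using hg.contDiffOn i j

lemma contDiffOn_inv {n : ℕ∞} (hg : IsRiemannianMetricOn n V g) (i j : Fin 2) :
    ContDiffOn ℝ (n : WithTop ℕ∞) (fun x => (g x)⁻¹ i j) V := by
  have hdet : ContDiffOn ℝ (n : WithTop ℕ∞) (fun x => (g x).det) V := by
    simp only [Matrix.det_fin_two]
    exact ((hg.contDiffOn 0 0).mul (hg.contDiffOn 1 1)).sub
      ((hg.contDiffOn 0 1).mul (hg.contDiffOn 1 0))
  have hadj : ContDiffOn ℝ (n : WithTop ℕ∞) (fun x => (g x).adjugate i j) V := by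
    simp only [Matrix.adjugate_fin_two]
    fin_cases i <;> fin_cases j
    · exact hg.contDiffOn 1 1
    · exact (hg.contDiffOn 0 1).neg
    · exact (hg.contDiffOn 1 0).neg
    · exact hg.contDiffOn 0 0
  refine ((hdet.inv fun x hx => (hg.det_pos hx).ne').mul hadj).congr fun x _ => ?_
  simp [Matrix.inv_def]

lemma pd_symm {n : ℕ∞} (hg : IsRiemannianMetricOn n V g) (hV : IsOpen V) (hx : x ∈ V)
    (l i j : Fin 2) : pd l (fun y => g y i j) x = pd l (fun y => g y j i) x :=
  pd_congr_on hV (fun _ hy => hg.symm hy i j) hx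

lemma christoffelLow_symm {n : ℕ∞} (hg : IsRiemannianMetricOn n V g) (hV : IsOpen V)
    (hx : x ∈ V) (l i k : Fin 2) : christoffelLow g l i k x = christoffelLow g l k i x := by
  rw [christoffelLow, christoffelLow, hg.pd_symm hV hx l i k]
  ring

lemma pd_eq_christoffelLow {n : ℕ∞} (hg : IsRiemannianMetricOn n V g) (hV : IsOpen V)
    (hx : x ∈ V) (i a b : Fin 2) :
    pd i (fun y => g y a b) x = christoffelLow g a i b x + christoffelLow g b i a x := by
  rw [christoffelLow, christoffelLow, hg.pd_symm hV hx i b a]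
  ring

/-- Differentiate `g⁻¹ g = 1`. -/
lemma pd_inv (hg : IsRiemannianMetricOn 1 V g) (hV : IsOpen V) (hx : x ∈ V) (i m l : Fin 2) :
    pd i (fun y => (g y)⁻¹ m l) x =
      - ∑ a : Fin 2, ∑ b : Fin 2, (g x)⁻¹ m a * pd i (fun y => g y a b) x * (g x)⁻¹ b l := by
  set P : Matrix (Fin 2) (Fin 2) ℝ := Matrix.of fun m l => pd i (fun y => (g y)⁻¹ m l) x
  set D : Matrix (Fin 2) (Fin 2) ℝ := Matrix.of fun a b => pd i (fun y => g y a b) x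
  have hu : ∀ y ∈ V, IsUnit (g y).det := fun y hy => (hg.det_pos hy).ne'.isUnit
  have hinv : ∀ a b, ContDiffOn ℝ 1 (fun y => (g y)⁻¹ a b) V := fun a b => by
    simpa using hg.contDiffOn_inv a b
  have hd1 := fun a b => differentiableAt_of_contDiffOn hV (hinv a b) hx
  have hd2 := fun a b => differentiableAt_of_contDiffOn hV (hg.contDiffOn_one a b) hx
  have h0 : P * g x + (g x)⁻¹ * D = 0 := by
    ext a c
    have h1 : pd i (fun y => ∑ b : Fin 2, (g y)⁻¹ a b * g y b c) x = 0 := by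
      rw [pd_congr_on (v := fun _ => (1 : Matrix (Fin 2) (Fin 2) ℝ) a c) hV (fun y hy => by
        rw [← Matrix.mul_apply, Matrix.nonsing_inv_mul _ (hu y hy)]) hx]
      simp [pd]
    have h2 := pd_sum (i := i) Finset.univ (w := fun b y => (g y)⁻¹ a b * g y b c)
      fun b _ => (hd1 a b).mul (hd2 b c)
    have h3 := fun b => pd_mul (i := i) (hd1 a b) (hd2 b c)
    simp only [h3, Finset.sum_add_distrib] at h2
    simpa [Matrix.mul_apply, P, D] using (h1.symm.trans h2).symm
  have h2 : P = - ((g x)⁻¹ * D * (g x)⁻¹) := by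
    have h3 : P * g x = - ((g x)⁻¹ * D) := eq_neg_of_add_eq_zero_left h0
    calc P = P * g x * (g x)⁻¹ := by
          rw [Matrix.mul_assoc, Matrix.mul_nonsing_inv _ (hu x hx), Matrix.mul_one]
      _ = _ := by rw [h3, Matrix.neg_mul]
  have h4 := congrFun (congrFun h2 m) l
  simp only [P, D, Matrix.of_apply, Matrix.neg_apply, Matrix.mul_apply, Fin.sum_univ_two] at h4 ⊢
  rw [h4]
  ring

/-- Raising an index multiplies by the C¹ functions `g⁻¹`. Their derivatives, rewritten by `∂_i
g_{ab} = Γ_{a,ib} + Γ_{b,ia}`, supply the quadratic terms. Thus `C - lowQuadratic` plays the role of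
the lowered curvature, and flatness is its vanishing. -/
lemma hasWeakCurl_christoffel (hg : IsRiemannianMetricOn 1 V g) (hV : IsOpen V)
    {C : Fin 2 → Fin 2 → Plane → ℝ}
    (hC : ∀ a k, HasWeakCurl V (christoffelLow g a 0 k) (christoffelLow g a 1 k) (C a k))
    (m k : Fin 2) :
    HasWeakCurl V (christoffel g m 0 k) (christoffel g m 1 k) (fun x =>
      ∑ a : Fin 2, (g x)⁻¹ m a * (C a k x - lowQuadratic g a k x) +
      ∑ p : Fin 2, (christoffel g m 0 p x * christoffel g p 1 k x -
        christoffel g m 1 p x * christoffel g p 0 k x)) := by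
  have hinv : ∀ a b, ContDiffOn ℝ 1 (fun y => (g y)⁻¹ a b) V := fun a b => by
    simpa using hg.contDiffOn_inv a b
  refine (HasWeakCurl.sum hV Finset.univ fun l _ => (hC l k).mul hV (hinv m l)).congr
    (fun x _ => christoffel_eq_sum g m 0 k x) (fun x _ => christoffel_eq_sum g m 1 k x)
    fun x hx => ?_
  simp only [hg.pd_inv hV hx, hg.pd_eq_christoffelLow hV hx, lowQuadratic, christoffel_eq_sum,
    Fin.sum_univ_two]
  ring

lemma contDiffOn_christoffelLow {m n : ℕ∞} (hg : IsRiemannianMetricOn n V g) (hV : IsOpen V)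
    (hmn : m + 1 ≤ n) (l i k : Fin 2) :
    ContDiffOn ℝ (m : WithTop ℕ∞) (christoffelLow g l i k) V := by
  have h := fun a b c => contDiffOn_pd (m := m) hV (hg.contDiffOn a b) (by exact_mod_cast hmn) c
  exact contDiffOn_const.mul (((h k l i).add (h i l k)).sub (h i k l))

lemma contDiffOn_christoffel {m n : ℕ∞} (hg : IsRiemannianMetricOn n V g) (hV : IsOpen V)
    (hmn : m + 1 ≤ n) (l i k : Fin 2) :
    ContDiffOn ℝ (m : WithTop ℕ∞) (christoffel g l i k) V := by
  rw [show christoffel g l i k = _ from funext fun x => christoffel_eq_sum g l i k x]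
  exact ContDiffOn.sum fun a _ =>
    ((hg.of_le (le_self_add.trans hmn)).contDiffOn_inv l a).mul
      (hg.contDiffOn_christoffelLow hV hmn a i k)

/-- By uniqueness `C` may be any expression for the weak curl, in particular one obtained without
differentiating the second derivatives of an immersion. -/
lemma gaussCurvature_mul_det (hg : IsRiemannianMetricOn 2 V g) (hV : IsOpen V)
    {C : Fin 2 → Fin 2 → Plane → ℝ}
    (hC : ∀ a k, HasWeakCurl V (christoffelLow g a 0 k) (christoffelLow g a 1 k) (C a k))
    (hx : x ∈ V) :
    gaussCurvature g x * (g x).det = lowQuadratic g 0 1 x - C 0 1 x := by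
  have hΓ : ∀ l i k, ContDiffOn ℝ 1 (christoffel g l i k) V := fun l i k => by
    simpa using hg.contDiffOn_christoffel (m := 1) hV (by norm_num) l i k
  have h1 : ∀ m, riemann g m 0 1 1 x =
      ∑ a : Fin 2, (g x)⁻¹ m a * (lowQuadratic g a 1 x - C a 1 x) := by
    intro m
    have := ((HasWeakCurl.of_contDiffOn hV (hΓ m 0 1) (hΓ m 1 1)).unique hV
      ((hg.of_le (by norm_num)).hasWeakCurl_christoffel hV hC m 1)) x hx
    simp only [riemann, Fin.sum_univ_two] at this ⊢
    linear_combination - this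
  have hdet := (hg.det_pos hx).ne'
  rw [gaussCurvature, div_mul_cancel₀ _ hdet]
  have h2 : g x * (g x)⁻¹ = 1 := Matrix.mul_nonsing_inv _ hdet.isUnit
  have h3 := congrFun (congrFun h2 0) 0
  have h4 := congrFun (congrFun h2 0) 1
  simp only [Matrix.mul_apply, Fin.sum_univ_two, Matrix.one_apply] at h3 h4
  simp only [h1, Fin.sum_univ_two]
  norm_num at h3 h4
  linear_combination (lowQuadratic g 0 1 x - C 0 1 x) * h3 +
    (lowQuadratic g 1 1 x - C 1 1 x) * h4

lemma lowQuadratic_antisymm {n : ℕ∞} (hg : IsRiemannianMetricOn n V g) (hx : x ∈ V)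
    (a k : Fin 2) : lowQuadratic g a k x = - lowQuadratic g k a x := by
  have hinv : (g x)⁻¹ 1 0 = (g x)⁻¹ 0 1 := by
    simp [Matrix.inv_def, Matrix.adjugate_fin_two, hg.symm hx 0 1]
  simp only [lowQuadratic, christoffel_eq_sum, Fin.sum_univ_two, hinv]
  ring

/-- The curl of the Christoffel symbols of the first kind is antisymmetric. -/
lemma pd_christoffelLow_antisymm (hg : IsRiemannianMetricOn 2 V g) (hV : IsOpen V) (hx : x ∈ V)
    (a k : Fin 2) :
    pd 1 (christoffelLow g a 0 k) x - pd 0 (christoffelLow g a 1 k) x =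
      - (pd 1 (christoffelLow g k 0 a) x - pd 0 (christoffelLow g k 1 a) x) := by
  have h2 : ∀ i j, ContDiffOn ℝ 2 (fun y => g y i j) V := fun i j => hg.contDiffOn i j
  have hd : ∀ c i j, DifferentiableAt ℝ (pd c fun y => g y i j) x := fun c i j =>
    differentiableAt_of_contDiffOn hV (contDiffOn_pd hV (h2 i j) (by norm_num) c) hx
  have key : ∀ s l i k, pd s (christoffelLow g l i k) x = 1 / 2 *
      (pd s (pd i fun y => g y k l) x + pd s (pd k fun y => g y i l) x -
        pd s (pd l fun y => g y i k) x) := by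
    intro s l i k
    have e := pd_const_mul (i := s) (1 / 2 : ℝ) (((hd i k l).fun_add (hd k i l)).fun_sub (hd l i k))
    rw [pd_sub ((hd i k l).fun_add (hd k i l)) (hd l i k), pd_add (hd i k l) (hd k i l)] at e
    exact e
  have hsym : ∀ s c i j, pd s (pd c fun y => g y i j) x = pd s (pd c fun y => g y j i) x :=
    fun s c i j => pd_congr_on hV (fun y hy => hg.pd_symm hV hy c i j) hx
  have hcomm := fun s c i j => pd_comm hV (h2 i j) hx s c
  rw [key, key, key, key, hcomm 0 1 k a, hcomm 0 1 a k]
  ring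

end IsRiemannianMetricOn

lemma isWeaklyFlatOn_of_hasWeakCurl (h : ∀ m k, HasWeakCurl V (christoffel g m 0 k)
    (christoffel g m 1 k) (fun x => ∑ p : Fin 2, (christoffel g m 0 p x * christoffel g p 1 k x -
        christoffel g m 1 p x * christoffel g p 0 k x))) : IsWeaklyFlatOn g V := by
  intro φ hφ hc hs l i j k
  have e := (h l k).integral_eq_zero φ (hφ.of_le (by exact_mod_cast le_top)) hc hs
  have e' := congrArg Neg.neg e
  rw [← integral_neg, neg_zero] at e'
  fin_cases i <;> fin_cases j
  · simp
  · exact e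
  · rw [← e']
    congr 1
    ext x
    simp only [Fin.sum_univ_two, Fin.zero_eta, Fin.mk_one]
    ring
  · simp

end

/-! ### Pointwise algebra of the Darboux equation -/

section

variable {V W : Set Plane} {g : Plane → Matrix (Fin 2) (Fin 2) ℝ} {x : Plane} {z : Plane → ℝ}

namespace IsRiemannianMetricOn

lemma inv_apply {n : ℕ∞} (hg : IsRiemannianMetricOn n V g) (hx : x ∈ V) :
    (g x)⁻¹ 0 0 = g x 1 1 / (g x).det ∧ (g x)⁻¹ 0 1 = - g x 0 1 / (g x).det ∧
      (g x)⁻¹ 1 0 = - g x 0 1 / (g x).det ∧ (g x)⁻¹ 1 1 = g x 0 0 / (g x).det := by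
  simp [Matrix.inv_def, Matrix.adjugate_fin_two, ← hg.symm hx 0 1, div_eq_inv_mul]

lemma det_eq {n : ℕ∞} (hg : IsRiemannianMetricOn n V g) (hx : x ∈ V) :
    (g x).det = g x 0 0 * g x 1 1 - g x 0 1 ^ 2 := by
  rw [Matrix.det_fin_two, ← hg.symm hx 0 1]
  ring

end IsRiemannianMetricOn

lemma posDef_fin_two {a b c : ℝ} {M : Matrix (Fin 2) (Fin 2) ℝ} (h00 : M 0 0 = a)
    (h01 : M 0 1 = b) (h10 : M 1 0 = b) (h11 : M 1 1 = c) (ha : 0 < a) (hd : 0 < a * c - b ^ 2) :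
    M.PosDef := by
  refine Matrix.PosDef.of_dotProduct_mulVec_pos ?_ fun v hv => ?_
  · ext i j
    fin_cases i <;> fin_cases j <;> simp [h01, h10]
  · have e : star v ⬝ᵥ (M.mulVec v) = a * v 0 ^ 2 + 2 * b * v 0 * v 1 + c * v 1 ^ 2 := by
      simp [dotProduct, Matrix.mulVec, Fin.sum_univ_two, h00, h01, h10, h11]
      ring
    rw [e]
    have h2 : a * (a * v 0 ^ 2 + 2 * b * v 0 * v 1 + c * v 1 ^ 2) =
        (a * v 0 + b * v 1) ^ 2 + (a * c - b ^ 2) * v 1 ^ 2 := by ring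
    refine pos_of_mul_pos_right (a := a) ?_ ha.le
    rw [h2]
    by_cases h1 : v 1 = 0
    · have h0 : v 0 ≠ 0 := fun h0 => hv (by ext i; fin_cases i <;> simp [h0, h1])
      rw [h1]
      have : 0 < (a * v 0) ^ 2 := by positivity
      simpa using this
    · have : 0 < (a * c - b ^ 2) * v 1 ^ 2 := by positivity
      nlinarith [sq_nonneg (a * v 0 + b * v 1)]

/-- Pointwise form of the equivalence of the Darboux equation for `z` and the flatness of
`g - dz²`. -/
lemma lowered_curvature_subSq_algebra {D E g00 g01 g11 p00 p01 p11 q00 q01 q11 z0 z1 s00 s01 s11 C : ℝ}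
    (hD : D = g00 * g11 - g01 ^ 2) (hD0 : D ≠ 0)
    (hE : E = (g00 - z0 * z0) * (g11 - z1 * z1) - (g01 - z0 * z1) ^ 2) (hE0 : E ≠ 0)
    (hdar : (s00 - ((g11 * p00 - g01 * q00) / D * z0 + (g00 * q00 - g01 * p00) / D * z1)) *
        (s11 - ((g11 * p11 - g01 * q11) / D * z0 + (g00 * q11 - g01 * p11) / D * z1)) -
        (s01 - ((g11 * p01 - g01 * q01) / D * z0 + (g00 * q01 - g01 * p01) / D * z1)) ^ 2 =
      ((p01 * (g11 * p01 - g01 * q01) + q01 * (g00 * q01 - g01 * p01)) / D -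
        (p00 * (g11 * p11 - g01 * q11) + q00 * (g00 * q11 - g01 * p11)) / D - C) *
      (1 - (g11 * z0 ^ 2 - 2 * g01 * z0 * z1 + g00 * z1 ^ 2) / D)) :
    ((p01 - z0 * s01) * ((g11 - z1 * z1) * (p01 - z0 * s01) - (g01 - z0 * z1) * (q01 - z1 * s01)) +
      (q01 - z1 * s01) * ((g00 - z0 * z0) * (q01 - z1 * s01) - (g01 - z0 * z1) * (p01 - z0 * s01)))
        / E -
    ((p00 - z0 * s00) * ((g11 - z1 * z1) * (p11 - z0 * s11) - (g01 - z0 * z1) * (q11 - z1 * s11)) +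
      (q00 - z1 * s00) * ((g00 - z0 * z0) * (q11 - z1 * s11) - (g01 - z0 * z1) * (p11 - z0 * s11)))
        / E = C + (s00 * s11 - s01 ^ 2) := by
  rw [← sub_div, div_eq_iff hE0]
  have h1 : (D * s00 - ((g11 * p00 - g01 * q00) * z0 + (g00 * q00 - g01 * p00) * z1)) *
        (D * s11 - ((g11 * p11 - g01 * q11) * z0 + (g00 * q11 - g01 * p11) * z1)) -
        (D * s01 - ((g11 * p01 - g01 * q01) * z0 + (g00 * q01 - g01 * p01) * z1)) ^ 2 =
      ((p01 * (g11 * p01 - g01 * q01) + q01 * (g00 * q01 - g01 * p01)) -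
        (p00 * (g11 * p11 - g01 * q11) + q00 * (g00 * q11 - g01 * p11)) - C * D) *
      (D - (g11 * z0 ^ 2 - 2 * g01 * z0 * z1 + g00 * z1 ^ 2)) := by
    field_simp at hdar
    linear_combination hdar
  -- Since `E = D - (g11 z0² - 2 g01 z0 z1 + g00 z1²)`, multiplication by `D` turns the goal into
  -- the Darboux equation cleared of denominators, up to sign.
  refine mul_left_cancel₀ hD0 ?_
  subst hD hE
  linear_combination - h1

/-- Pointwise form of the Theorema Egregium for one component `a i, b i` of the differential. -/
lemma darboux_algebra {D g00 g01 g11 : ℝ} {a b p q r : Fin 3 → ℝ}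
    (h00 : g00 = ∑ i, a i * a i) (h01 : g01 = ∑ i, a i * b i) (h11 : g11 = ∑ i, b i * b i)
    (hD : D = g00 * g11 - g01 ^ 2) (hD0 : D ≠ 0) (α : Fin 3) {p00 p01 p11 q00 q01 q11 : ℝ}
    (hp00 : p00 = ∑ i, a i * p i) (hp01 : p01 = ∑ i, a i * q i) (hp11 : p11 = ∑ i, a i * r i)
    (hq00 : q00 = ∑ i, b i * p i) (hq01 : q01 = ∑ i, b i * q i) (hq11 : q11 = ∑ i, b i * r i) :
    (p α - ((g11 * p00 - g01 * q00) / D * a α + (g00 * q00 - g01 * p00) / D * b α)) *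
        (r α - ((g11 * p11 - g01 * q11) / D * a α + (g00 * q11 - g01 * p11) / D * b α)) -
        (q α - ((g11 * p01 - g01 * q01) / D * a α + (g00 * q01 - g01 * p01) / D * b α)) ^ 2 =
      ((p01 * (g11 * p01 - g01 * q01) + q01 * (g00 * q01 - g01 * p01)) / D -
        (p00 * (g11 * p11 - g01 * q11) + q00 * (g00 * q11 - g01 * p11)) / D -
        (∑ i, (q i * q i - p i * r i))) *
      (1 - (g11 * (a α) ^ 2 - 2 * g01 * a α * b α + g00 * (b α) ^ 2) / D) := by
  -- `N` is the unnormalized normal `a × b`, of squared length `D`; leaving it unnormalized avoids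
  -- square roots.
  obtain ⟨N, hN, hN'⟩ : ∃ N : Fin 3 → ℝ, (N α ^ 2 = D - (g11 * (a α) ^ 2 - 2 * g01 * a α * b α +
      g00 * (b α) ^ 2)) ∧ N = ![a 1 * b 2 - a 2 * b 1, a 2 * b 0 - a 0 * b 2,
        a 0 * b 1 - a 1 * b 0] := by
    refine ⟨_, ?_, rfl⟩
    rw [hD, h00, h01, h11]
    simp only [Fin.sum_univ_three]
    fin_cases α <;> simp <;> ring
  -- Removing the tangential part of `w` leaves its normal part, here scaled by `D`.
  have hproj : ∀ (w : Fin 3 → ℝ), D * w α - ((g11 * (∑ i, a i * w i) - g01 * (∑ i, b i * w i)) * a α +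
      (g00 * (∑ i, b i * w i) - g01 * (∑ i, a i * w i)) * b α) = N α * ∑ i, N i * w i := by
    intro w
    rw [hN', hD, h00, h01, h11]
    simp only [Fin.sum_univ_three]
    fin_cases α <;> simp <;> ring
  -- The Gauss equation: the lowered curvature is the determinant of the second fundamental form.
  have hgauss : (p01 * (g11 * p01 - g01 * q01) + q01 * (g00 * q01 - g01 * p01)) -
        (p00 * (g11 * p11 - g01 * q11) + q00 * (g00 * q11 - g01 * p11)) -
        D * (∑ i, (q i * q i - p i * r i)) =
      (∑ i, N i * p i) * (∑ i, N i * r i) - (∑ i, N i * q i) ^ 2 := by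
    rw [hp00, hp01, hp11, hq00, hq01, hq11, hN', hD, h00, h01, h11]
    simp only [Fin.sum_univ_three]
    simp
    ring
  have hp := hproj p
  have hq := hproj q
  have hr := hproj r
  rw [← hp00, ← hq00] at hp
  rw [← hp01, ← hq01] at hq
  rw [← hp11, ← hq11] at hr
  generalize ∑ i, N i * p i = P at *
  generalize ∑ i, N i * q i = Q at *
  generalize ∑ i, N i * r i = R at *
  generalize ∑ i, (q i * q i - p i * r i) = S at *
  have e : ∀ w c d : ℝ, w - (c / D * a α + d / D * b α) = (D * w - (c * a α + d * b α)) / D := by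
    intro w c d
    field_simp
  rw [e, e, e, hp, hq, hr]
  have e1 : (1 - (g11 * (a α) ^ 2 - 2 * g01 * a α * b α + g00 * (b α) ^ 2) / D) = N α ^ 2 / D := by
    rw [hN]
    field_simp
  have e2 : ((p01 * (g11 * p01 - g01 * q01) + q01 * (g00 * q01 - g01 * p01)) / D -
        (p00 * (g11 * p11 - g01 * q11) + q00 * (g00 * q11 - g01 * p11)) / D - S) =
      (P * R - Q ^ 2) / D := by
    rw [← hgauss]
    field_simp
  rw [e1, e2]
  field_simp

end

/-! ### The Darboux equation for immersions, and flatness of `g - dz²` -/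

section

variable {V W : Set Plane} {g : Plane → Matrix (Fin 2) (Fin 2) ℝ} {x : Plane} {z : Plane → ℝ}

namespace IsRiemannianMetricOn

lemma christoffel_zero {n : ℕ∞} (hg : IsRiemannianMetricOn n V g) (hx : x ∈ V) (i k : Fin 2) :
    christoffel g 0 i k x = (g x 1 1 * christoffelLow g 0 i k x -
      g x 0 1 * christoffelLow g 1 i k x) / (g x).det := by
  obtain ⟨h1, h2, h3, h4⟩ := hg.inv_apply hx
  rw [christoffel_eq_sum, Fin.sum_univ_two, h1, h2]
  ring

lemma christoffel_one {n : ℕ∞} (hg : IsRiemannianMetricOn n V g) (hx : x ∈ V) (i k : Fin 2) :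
    christoffel g 1 i k x = (g x 0 0 * christoffelLow g 1 i k x -
      g x 0 1 * christoffelLow g 0 i k x) / (g x).det := by
  obtain ⟨h1, h2, h3, h4⟩ := hg.inv_apply hx
  rw [christoffel_eq_sum, Fin.sum_univ_two, h3, h4]
  ring

lemma gradNormSq_eq {n : ℕ∞} (hg : IsRiemannianMetricOn n V g) (hx : x ∈ V) (z : Plane → ℝ) :
    gradNormSq g z x = (g x 1 1 * pd 0 z x ^ 2 - 2 * g x 0 1 * pd 0 z x * pd 1 z x +
      g x 0 0 * pd 1 z x ^ 2) / (g x).det := by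
  obtain ⟨h1, h2, h3, h4⟩ := hg.inv_apply hx
  simp only [gradNormSq, Fin.sum_univ_two, h1, h2, h3, h4]
  ring

lemma lowQuadratic_eq {n : ℕ∞} (hg : IsRiemannianMetricOn n V g) (hV : IsOpen V) (hx : x ∈ V) :
    lowQuadratic g 0 1 x =
      (christoffelLow g 0 0 1 x * (g x 1 1 * christoffelLow g 0 0 1 x -
          g x 0 1 * christoffelLow g 1 0 1 x) +
        christoffelLow g 1 0 1 x * (g x 0 0 * christoffelLow g 1 0 1 x -
          g x 0 1 * christoffelLow g 0 0 1 x)) / (g x).det -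
      (christoffelLow g 0 0 0 x * (g x 1 1 * christoffelLow g 0 1 1 x -
          g x 0 1 * christoffelLow g 1 1 1 x) +
        christoffelLow g 1 0 0 x * (g x 0 0 * christoffelLow g 1 1 1 x -
          g x 0 1 * christoffelLow g 0 1 1 x)) / (g x).det := by
  simp only [lowQuadratic, Fin.sum_univ_two, hg.christoffel_zero hx, hg.christoffel_one hx,
    hg.christoffelLow_symm hV hx _ 1 0]
  ring

lemma covHessian_det_eq {n : ℕ∞} (hg : IsRiemannianMetricOn n V g) (hV : IsOpen V) (hx : x ∈ V)
    (hz : ContDiffOn ℝ 2 z V) : (covHessian g z x).det =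
      (pd 0 (pd 0 z) x - ((g x 1 1 * christoffelLow g 0 0 0 x -
          g x 0 1 * christoffelLow g 1 0 0 x) / (g x).det * pd 0 z x +
        (g x 0 0 * christoffelLow g 1 0 0 x - g x 0 1 * christoffelLow g 0 0 0 x) /
          (g x).det * pd 1 z x)) *
      (pd 1 (pd 1 z) x - ((g x 1 1 * christoffelLow g 0 1 1 x -
          g x 0 1 * christoffelLow g 1 1 1 x) / (g x).det * pd 0 z x +
        (g x 0 0 * christoffelLow g 1 1 1 x - g x 0 1 * christoffelLow g 0 1 1 x) /
          (g x).det * pd 1 z x)) -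
      (pd 0 (pd 1 z) x - ((g x 1 1 * christoffelLow g 0 0 1 x -
          g x 0 1 * christoffelLow g 1 0 1 x) / (g x).det * pd 0 z x +
        (g x 0 0 * christoffelLow g 1 0 1 x - g x 0 1 * christoffelLow g 0 0 1 x) /
          (g x).det * pd 1 z x)) ^ 2 := by
  simp only [covHessian, Matrix.det_fin_two, Matrix.of_apply, Fin.sum_univ_two,
    hg.christoffel_zero hx, hg.christoffel_one hx, hg.christoffelLow_symm hV hx _ 1 0,
    pd_comm hV hz hx 1 0]
  ring

end IsRiemannianMetricOn

section Immersion

variable {F : Plane → Space}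

lemma IsIsometricImmersionOn.contDiffOn_apply {n : ℕ∞} (hF : IsIsometricImmersionOn n V g F)
    (β : Fin 3) : ContDiffOn ℝ (n : WithTop ℕ∞) (fun y => F y β) V :=
  (contDiff_piLp_apply (p := 2) (i := β)).comp_contDiffOn hF.contDiffOn

lemma IsIsometricImmersionOn.mono {n : ℕ∞} (hF : IsIsometricImmersionOn n V g F) (hW : W ⊆ V) :
    IsIsometricImmersionOn n W g F :=
  ⟨hF.contDiffOn.mono hW, fun x hx => hF.isometric x (hW hx)⟩

lemma IsIsometricImmersionOn.of_le {m n : ℕ∞} (hF : IsIsometricImmersionOn n V g F)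
    (hmn : m ≤ n) : IsIsometricImmersionOn m V g F :=
  ⟨hF.contDiffOn.of_le (by exact_mod_cast hmn), hF.isometric⟩

lemma IsIsometricImmersionOn.christoffelLow_eq (hV : IsOpen V)
    (hF : IsIsometricImmersionOn 2 V g F) (hx : x ∈ V) (l i k : Fin 2) :
    christoffelLow g l i k x =
      ∑ β, pd l (fun y => F y β) x * pd i (pd k fun y => F y β) x := by
  have hc : ∀ β, ContDiffOn ℝ 2 (fun y => F y β) V := fun β => hF.contDiffOn_apply β
  have hd : ∀ c β, DifferentiableAt ℝ (pd c fun y => F y β) x := fun c β =>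
    differentiableAt_of_contDiffOn hV (contDiffOn_pd hV (hc β) (by norm_num) c) hx
  have key : ∀ s a b, pd s (fun y => g y a b) x =
      ∑ β, (pd s (pd a fun y => F y β) x * pd b (fun y => F y β) x +
        pd a (fun y => F y β) x * pd s (pd b fun y => F y β) x) := by
    intro s a b
    rw [pd_congr_on (v := fun y => ∑ β, pd a (fun y => F y β) y * pd b (fun y => F y β) y) hV
      (fun y hy => (hF.isometric y hy a b).symm) hx]
    have h1 := pd_sum (i := s) Finset.univ
      (w := fun β y => pd a (fun y => F y β) y * pd b (fun y => F y β) y)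
      fun β _ => (hd a β).mul (hd b β)
    rw [h1]
    exact Finset.sum_congr rfl fun β _ => pd_mul (hd a β) (hd b β)
  have hcomm := fun β s c => pd_comm hV (hc β) hx s c
  rw [christoffelLow, key, key, key, ← Finset.sum_add_distrib, ← Finset.sum_sub_distrib,
    Finset.mul_sum]
  refine Finset.sum_congr rfl fun β _ => ?_
  rw [hcomm β k i, hcomm β l i, hcomm β l k]
  ring

/-- The form is `∂_a F · d(∂_k F)`, a sum of products `f dv` of C¹ functions, so its weak curl
involves no third derivatives of `F`. -/
lemma IsIsometricImmersionOn.hasWeakCurl_christoffelLow (hV : IsOpen V)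
    (hF : IsIsometricImmersionOn 2 V g F) (a k : Fin 2) :
    HasWeakCurl V (christoffelLow g a 0 k) (christoffelLow g a 1 k) (fun x =>
      ∑ β, (pd 1 (pd a fun y => F y β) x * pd 0 (pd k fun y => F y β) x -
        pd 0 (pd a fun y => F y β) x * pd 1 (pd k fun y => F y β) x)) := by
  have hc : ∀ c β, ContDiffOn ℝ 1 (pd c fun y => F y β) V := fun c β =>
    contDiffOn_pd hV (hF.contDiffOn_apply β) (by norm_num) c
  exact (HasWeakCurl.sum hV Finset.univ fun β _ =>
    HasWeakCurl.mul_pd hV (hc a β) (hc k β)).congr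
    (fun x hx => hF.christoffelLow_eq hV hx a 0 k) (fun x hx => hF.christoffelLow_eq hV hx a 1 k)
    fun _ _ => rfl

theorem IsIsometricImmersionOn.satisfiesDarbouxOn (hV : IsOpen V)
    (hg : IsRiemannianMetricOn 2 V g) (hF : IsIsometricImmersionOn 2 V g F) (α : Fin 3) :
    SatisfiesDarbouxOn g V (fun x => F x α) := by
  intro x hx
  have hc : ∀ β, ContDiffOn ℝ 2 (fun y => F y β) V := fun β => hF.contDiffOn_apply β
  have h := darboux_algebra (D := (g x).det)
    (a := fun β => pd 0 (fun y => F y β) x) (b := fun β => pd 1 (fun y => F y β) x)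
    (p := fun β => pd 0 (pd 0 fun y => F y β) x) (q := fun β => pd 0 (pd 1 fun y => F y β) x)
    (r := fun β => pd 1 (pd 1 fun y => F y β) x)
    (hF.isometric x hx 0 0).symm (hF.isometric x hx 0 1).symm (hF.isometric x hx 1 1).symm
    (hg.det_eq hx) (hg.det_pos hx).ne' α
    (hF.christoffelLow_eq hV hx 0 0 0) (hF.christoffelLow_eq hV hx 0 0 1)
    (hF.christoffelLow_eq hV hx 0 1 1) (hF.christoffelLow_eq hV hx 1 0 0)
    (hF.christoffelLow_eq hV hx 1 0 1) (hF.christoffelLow_eq hV hx 1 1 1)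
  rw [hg.gaussCurvature_mul_det hV (hF.hasWeakCurl_christoffelLow hV) hx,
    hg.covHessian_det_eq hV hx (hc α), hg.lowQuadratic_eq hV hx, hg.gradNormSq_eq hx, h]
  simp only [fun β => pd_comm hV (hc β) hx 1 0]

end Immersion

section Subtraction

/-- The determinant of `g - dz²` is `|g| (1 - |∇z|²)`. For the corner entry, `g₀₀ |g| |∇z|² = |g|
(∂₀z)² + (g₀₀ ∂₁z - g₀₁ ∂₀z)²`. -/
lemma subSq_det_pos {n : ℕ∞} (hg : IsRiemannianMetricOn n V g) (hx : x ∈ V)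
    (hz : gradNormSq g z x < 1) : 0 < g x 0 0 - pd 0 z x * pd 0 z x ∧
      0 < (g x 0 0 - pd 0 z x * pd 0 z x) * (g x 1 1 - pd 1 z x * pd 1 z x) -
        (g x 0 1 - pd 0 z x * pd 1 z x) ^ 2 := by
  have hD := hg.det_pos hx
  have h00 : 0 < g x 0 0 := (hg.posDef x hx).diag_pos
  rw [hg.gradNormSq_eq hx, div_lt_one hD] at hz
  have hDe := hg.det_eq hx
  refine ⟨?_, by nlinarith⟩
  refine pos_of_mul_pos_right (a := (g x).det) ?_ hD.le
  nlinarith [sq_nonneg (g x 0 0 * pd 1 z x - g x 0 1 * pd 0 z x)]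

lemma IsRiemannianMetricOn.subSq {m n : ℕ∞} (hg : IsRiemannianMetricOn n V g) (hV : IsOpen V)
    (hz : ContDiffOn ℝ (n : WithTop ℕ∞) z V) (hz1 : ∀ x ∈ V, gradNormSq g z x < 1)
    (hmn : m + 1 ≤ n) : IsRiemannianMetricOn m V (subSq g z) := by
  refine ⟨fun i j => ?_, fun x hx => ?_⟩
  · have hp := fun c => contDiffOn_pd (m := (m : WithTop ℕ∞)) hV hz (by exact_mod_cast hmn) c
    exact ((hg.of_le (le_self_add.trans hmn)).contDiffOn i j).sub ((hp i).mul (hp j))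
  · obtain ⟨h1, h2⟩ := subSq_det_pos hg hx (hz1 x hx)
    refine posDef_fin_two rfl rfl ?_ rfl h1 h2
    simp [LocalSurface.subSq, hg.symm hx 1 0, mul_comm]

lemma christoffelLow_subSq (hg : IsRiemannianMetricOn 1 V g) (hV : IsOpen V)
    (hz : ContDiffOn ℝ 2 z V) (hx : x ∈ V) (l i k : Fin 2) :
    christoffelLow (subSq g z) l i k x =
      christoffelLow g l i k x - pd l z x * pd i (pd k z) x := by
  have hd : ∀ c, DifferentiableAt ℝ (pd c z) x := fun c =>
    differentiableAt_of_contDiffOn hV (contDiffOn_pd hV hz (by norm_num) c) hx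
  have hd2 := fun a b => differentiableAt_of_contDiffOn hV (hg.contDiffOn_one a b) hx
  have key : ∀ s a b, pd s (fun y => subSq g z y a b) x = pd s (fun y => g y a b) x -
      (pd s (pd a z) x * pd b z x + pd a z x * pd s (pd b z) x) := by
    intro s a b
    rw [← pd_mul (hd a) (hd b)]
    exact pd_sub (hd2 a b) ((hd a).mul (hd b))
  have hcomm := fun s c => pd_comm hV hz hx s c
  rw [christoffelLow, key, key, key, hcomm k i, hcomm l i, hcomm l k, christoffelLow]
  ring

/-- Subtracting `dz²` changes the lowered symbols by the form `-∂_a z d(∂_k z)`, with C¹ ingredients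
even when the symbols themselves are only continuous. -/
lemma hasWeakCurl_christoffelLow_subSq (hg : IsRiemannianMetricOn 2 V g) (hV : IsOpen V)
    (hz : ContDiffOn ℝ 2 z V) (a k : Fin 2) :
    HasWeakCurl V (christoffelLow (subSq g z) a 0 k) (christoffelLow (subSq g z) a 1 k)
      (fun x => (pd 1 (christoffelLow g a 0 k) x - pd 0 (christoffelLow g a 1 k) x) +
        (pd 0 (pd a z) x * pd 1 (pd k z) x - pd 1 (pd a z) x * pd 0 (pd k z) x)) := by
  have hg1 : IsRiemannianMetricOn 1 V g := hg.of_le (by norm_num)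
  have hL : ∀ i, ContDiffOn ℝ 1 (christoffelLow g a i k) V := fun i => by
    simpa using hg.contDiffOn_christoffelLow (m := 1) hV (by norm_num) a i k
  have hp : ∀ c, ContDiffOn ℝ 1 (pd c z) V := fun c => contDiffOn_pd hV hz (by norm_num) c
  refine ((HasWeakCurl.of_contDiffOn hV (hL 0) (hL 1)).add hV
    (HasWeakCurl.mul_pd hV (contDiffOn_const (c := (-1 : ℝ)) |>.mul (hp a)) (hp k))).congr
    (fun x hx => ?_) (fun x hx => ?_) fun x hx => ?_
  · rw [christoffelLow_subSq hg1 hV hz hx]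
    ring
  · rw [christoffelLow_subSq hg1 hV hz hx]
    ring
  · have hd := differentiableAt_of_contDiffOn hV (hp a) hx
    rw [pd_const_mul _ hd, pd_const_mul _ hd]
    ring

/-- The Darboux equation for `z` makes the lowered curvature of `g - dz²` vanish. -/
lemma lowQuadratic_subSq (hg : IsRiemannianMetricOn 2 V g) (hV : IsOpen V)
    (hz : ContDiffOn ℝ 2 z V) (hz1 : ∀ x ∈ V, gradNormSq g z x < 1)
    (hdar : SatisfiesDarbouxOn g V z) (hx : x ∈ V) (a k : Fin 2) :
    lowQuadratic (subSq g z) a k x =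
      (pd 1 (christoffelLow g a 0 k) x - pd 0 (christoffelLow g a 1 k) x) +
        (pd 0 (pd a z) x * pd 1 (pd k z) x - pd 1 (pd a z) x * pd 0 (pd k z) x) := by
  have hg1 : IsRiemannianMetricOn 1 V g := hg.of_le (by norm_num)
  have hh : IsRiemannianMetricOn 1 V (subSq g z) :=
    hg.subSq hV hz hz1 (by norm_num)
  have hL : ∀ a i k, ContDiffOn ℝ 1 (christoffelLow g a i k) V := fun a i k => by
    simpa using hg.contDiffOn_christoffelLow (m := 1) hV (by norm_num) a i k
  -- Both sides are antisymmetric in `a, k`, so this is the only independent component, and it is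
  -- the Darboux equation.
  have h01 : lowQuadratic (subSq g z) 0 1 x =
      (pd 1 (christoffelLow g 0 0 1) x - pd 0 (christoffelLow g 0 1 1) x) +
        (pd 0 (pd 0 z) x * pd 1 (pd 1 z) x - pd 1 (pd 0 z) x * pd 0 (pd 1 z) x) := by
    have e := hdar x hx
    rw [hg.gaussCurvature_mul_det hV
      (fun a k => HasWeakCurl.of_contDiffOn hV (hL a 0 k) (hL a 1 k)) hx,
      hg.covHessian_det_eq hV hx hz, hg.lowQuadratic_eq hV hx, hg.gradNormSq_eq hx] at e
    have hdet := hh.det_eq hx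
    have := lowered_curvature_subSq_algebra (hg.det_eq hx) (hg.det_pos hx).ne' hdet
      (hh.det_pos hx).ne' e
    rw [pd_comm hV hz hx 1 0, ← pow_two, ← this, hh.lowQuadratic_eq hV hx]
    simp only [christoffelLow_subSq hg1 hV hz hx]
    rfl
  have hanti := hg.pd_christoffelLow_antisymm hV hx
  have hdiag : ∀ b, lowQuadratic (subSq g z) b b x =
      (pd 1 (christoffelLow g b 0 b) x - pd 0 (christoffelLow g b 1 b) x) +
        (pd 0 (pd b z) x * pd 1 (pd b z) x - pd 1 (pd b z) x * pd 0 (pd b z) x) := by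
    intro b
    have h1 := hh.lowQuadratic_antisymm hx b b
    have h2 := hanti b b
    linarith
  fin_cases a <;> fin_cases k
  · exact hdiag 0
  · exact h01
  · have h1 := hh.lowQuadratic_antisymm hx 1 0
    have h2 := hanti 1 0
    change lowQuadratic (subSq g z) 1 0 x =
      (pd 1 (christoffelLow g 1 0 0) x - pd 0 (christoffelLow g 1 1 0) x) +
        (pd 0 (pd 1 z) x * pd 1 (pd 0 z) x - pd 1 (pd 1 z) x * pd 0 (pd 0 z) x)
    linarith
  · exact hdiag 1

/-- The Christoffel symbols of `g - dz²` satisfy the flatness equation weakly. -/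
theorem hasWeakCurl_christoffel_subSq (hg : IsRiemannianMetricOn 2 V g) (hV : IsOpen V)
    (hz : ContDiffOn ℝ 2 z V) (hz1 : ∀ x ∈ V, gradNormSq g z x < 1)
    (hdar : SatisfiesDarbouxOn g V z) (m k : Fin 2) :
    HasWeakCurl V (christoffel (subSq g z) m 0 k) (christoffel (subSq g z) m 1 k) (fun x =>
      ∑ p : Fin 2, (christoffel (subSq g z) m 0 p x * christoffel (subSq g z) p 1 k x -
        christoffel (subSq g z) m 1 p x * christoffel (subSq g z) p 0 k x)) := by
  have hh : IsRiemannianMetricOn 1 V (subSq g z) := hg.subSq hV hz hz1 (by norm_num)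
  refine (hh.hasWeakCurl_christoffel hV (hasWeakCurl_christoffelLow_subSq hg hV hz) m k).congr
    (fun _ _ => rfl) (fun _ _ => rfl) fun x hx => ?_
  simp [lowQuadratic_subSq hg hV hz hz1 hdar hx]

/-- From `n = 3` on, `g - dz²` is C², so its classical curvature is governed by the same weak curl.
-/
theorem gaussCurvature_subSq {n : ℕ∞} (hn : 3 ≤ n) (hg : IsRiemannianMetricOn n V g)
    (hV : IsOpen V) (hz : ContDiffOn ℝ (n : WithTop ℕ∞) z V)
    (hz1 : ∀ x ∈ V, gradNormSq g z x < 1) (hdar : SatisfiesDarbouxOn g V z) (hx : x ∈ V) :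
    gaussCurvature (subSq g z) x = 0 := by
  have hn2 : (2 : ℕ∞) ≤ n := le_trans (by norm_num) hn
  have hg2 : IsRiemannianMetricOn 2 V g := hg.of_le hn2
  have hz2 : ContDiffOn ℝ 2 z V := hz.of_le
    (show ((2 : ℕ∞) : WithTop ℕ∞) ≤ n by exact_mod_cast hn2)
  have hh : IsRiemannianMetricOn 2 V (subSq g z) := hg.subSq hV hz hz1 (by norm_num; exact hn)
  have h := hh.gaussCurvature_mul_det hV (hasWeakCurl_christoffelLow_subSq hg2 hV hz2) hx
  rw [lowQuadratic_subSq hg2 hV hz2 hz1 hdar hx, sub_self] at h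
  exact (mul_eq_zero.mp h).resolve_right (hh.det_pos hx).ne'

end Subtraction

end

/-! ### Flat coordinates by rotating an orthonormal coframe -/

section

variable {V W : Set Plane} {g h : Plane → Matrix (Fin 2) (Fin 2) ℝ} {x : Plane} {z : Plane → ℝ}

/-- `(r, c)` and `(0, q)` are the components of the `h`-orthonormal coframe on `V` obtained from
`(dx⁰, dx¹)` by the Gram-Schmidt process. -/
structure IsCholeskyOn (V : Set Plane) (h : Plane → Matrix (Fin 2) (Fin 2) ℝ)
    (r c q : Plane → ℝ) : Prop where
  pos_r : ∀ x ∈ V, 0 < r x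
  pos_q : ∀ x ∈ V, 0 < q x
  eq00 : ∀ x ∈ V, h x 0 0 = r x * r x
  eq01 : ∀ x ∈ V, h x 0 1 = r x * c x
  eq11 : ∀ x ∈ V, h x 1 1 = c x * c x + q x * q x

lemma exists_isCholeskyOn {n : ℕ∞} (hh : IsRiemannianMetricOn n V h) :
    ∃ r c q : Plane → ℝ, IsCholeskyOn V h r c q ∧
      ∀ m : ℕ∞, IsRiemannianMetricOn m V h → ContDiffOn ℝ (m : WithTop ℕ∞) r V ∧
        ContDiffOn ℝ (m : WithTop ℕ∞) c V ∧ ContDiffOn ℝ (m : WithTop ℕ∞) q V := by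
  have h00 : ∀ x ∈ V, 0 < h x 0 0 := fun x hx => (hh.posDef x hx).diag_pos
  have hr : ∀ x ∈ V, 0 < √(h x 0 0) := fun x hx => Real.sqrt_pos.mpr (h00 x hx)
  have hq : ∀ x ∈ V, 0 < h x 1 1 - h x 0 1 / √(h x 0 0) * (h x 0 1 / √(h x 0 0)) := by
    intro x hx
    have hd := hh.det_pos hx
    rw [hh.det_eq hx] at hd
    rw [div_mul_div_comm, Real.mul_self_sqrt (h00 x hx).le, sub_pos, div_lt_iff₀ (h00 x hx)]
    linarith
  refine ⟨fun x => √(h x 0 0), fun x => h x 0 1 / √(h x 0 0),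
    fun x => √(h x 1 1 - h x 0 1 / √(h x 0 0) * (h x 0 1 / √(h x 0 0))),
    ⟨hr, fun x hx => Real.sqrt_pos.mpr (hq x hx), fun x hx => ?_, fun x hx => ?_, fun x hx => ?_⟩,
    fun m hm => ?_⟩
  · exact (Real.mul_self_sqrt (h00 x hx).le).symm
  · exact (mul_div_cancel₀ _ (hr x hx).ne').symm
  · rw [Real.mul_self_sqrt (hq x hx).le]
    ring
  · have hrm := (hm.contDiffOn 0 0).sqrt fun x hx => (h00 x hx).ne'
    have hcm := (hm.contDiffOn 0 1).div hrm fun x hx => (hr x hx).ne'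
    exact ⟨hrm, hcm, ((hm.contDiffOn 1 1).sub (hcm.mul hcm)).sqrt fun x hx => (hq x hx).ne'⟩

section ConnectionForm

variable {r c q : Plane → ℝ}

/-- The `dx⁰`-component of the connection form of the coframe `(r, c), (0, q)`. -/
def connectionForm₀ (r c q : Plane → ℝ) (x : Plane) : ℝ :=
  (pd 0 c x - pd 1 r x) / q x

/-- The `dx¹`-component of the connection form of the coframe `(r, c), (0, q)`. -/
def connectionForm₁ (r c q : Plane → ℝ) (x : Plane) : ℝ :=
  (pd 0 q x + c x * connectionForm₀ r c q x) / r x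

lemma IsCholeskyOn.pd_eq (hC : IsCholeskyOn V h r c q) (hV : IsOpen V)
    (hh : IsRiemannianMetricOn 1 V h) (hr : ContDiffOn ℝ 1 r V) (hc : ContDiffOn ℝ 1 c V)
    (hq : ContDiffOn ℝ 1 q V) (hx : x ∈ V) (i : Fin 2) :
    pd i (fun y => h y 0 0) x = 2 * r x * pd i r x ∧
    pd i (fun y => h y 0 1) x = pd i r x * c x + r x * pd i c x ∧
    pd i (fun y => h y 1 0) x = pd i r x * c x + r x * pd i c x ∧
    pd i (fun y => h y 1 1) x = 2 * c x * pd i c x + 2 * q x * pd i q x := by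
  have dr := differentiableAt_of_contDiffOn hV hr hx
  have dc := differentiableAt_of_contDiffOn hV hc hx
  have dq := differentiableAt_of_contDiffOn hV hq hx
  have h01 : pd i (fun y => h y 0 1) x = pd i r x * c x + r x * pd i c x := by
    rw [pd_congr_on hV hC.eq01 hx, pd_mul dr dc]
  refine ⟨?_, h01, ?_, ?_⟩
  · rw [pd_congr_on hV hC.eq00 hx, pd_mul dr dr]
    ring
  · rw [hh.pd_symm hV hx, h01]
  · rw [pd_congr_on hV hC.eq11 hx, pd_add (dc.fun_mul dc) (dq.fun_mul dq), pd_mul dc dc, pd_mul dq dq]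
    ring

lemma IsCholeskyOn.christoffel_eq (hC : IsCholeskyOn V h r c q) (hV : IsOpen V)
    (hh : IsRiemannianMetricOn 1 V h) (hr : ContDiffOn ℝ 1 r V) (hc : ContDiffOn ℝ 1 c V)
    (hq : ContDiffOn ℝ 1 q V) (hx : x ∈ V) :
    christoffel h 1 0 0 x = r x / q x * connectionForm₀ r c q x ∧
    christoffel h 1 1 0 x = r x / q x * connectionForm₁ r c q x ∧
    christoffel h 1 0 1 x = r x / q x * connectionForm₁ r c q x ∧
    christoffel h 0 0 0 x = pd 0 r x / r x - c x / q x * connectionForm₀ r c q x ∧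
    christoffel h 0 1 0 x = pd 1 r x / r x - c x / q x * connectionForm₁ r c q x ∧
    christoffel h 1 1 1 x = pd 1 q x / q x + c x / q x * connectionForm₁ r c q x := by
  have hr0 := (hC.pos_r x hx).ne'
  have hq0 := (hC.pos_q x hx).ne'
  have hdet : (h x).det = r x ^ 2 * q x ^ 2 := by
    rw [hh.det_eq hx, hC.eq00 x hx, hC.eq01 x hx, hC.eq11 x hx]
    ring
  have key := hC.pd_eq hV hh hr hc hq hx
  simp only [hh.christoffel_zero hx, hh.christoffel_one hx, christoffelLow, (key _).1,
    (key _).2.1, (key _).2.2.1, (key _).2.2.2, hdet, hC.eq00 x hx, hC.eq01 x hx, hC.eq11 x hx,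
    connectionForm₁, connectionForm₀]
  refine ⟨?_, ?_, ?_, ?_, ?_, ?_⟩ <;> field_simp <;> ring

/-- Weak flatness of `h` says that the connection form of the coframe is weakly closed. -/
lemma IsCholeskyOn.hasWeakCurl_connectionForm (hC : IsCholeskyOn V h r c q) (hV : IsOpen V)
    (hh : IsRiemannianMetricOn 1 V h) (hr : ContDiffOn ℝ 1 r V) (hc : ContDiffOn ℝ 1 c V)
    (hq : ContDiffOn ℝ 1 q V)
    (hflat : HasWeakCurl V (christoffel h 1 0 0) (christoffel h 1 1 0) (fun x =>
      ∑ p : Fin 2, (christoffel h 1 0 p x * christoffel h p 1 0 x -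
        christoffel h 1 1 p x * christoffel h p 0 0 x))) :
    HasWeakCurl V (connectionForm₀ r c q) (connectionForm₁ r c q) (fun _ => 0) := by
  have hr0 : ∀ x ∈ V, r x ≠ 0 := fun x hx => (hC.pos_r x hx).ne'
  -- The symbols satisfy `Γ¹_{i0} = (r / q) ω_i`, so multiplying the flatness equation by `q / r`
  -- isolates the connection form; the quadratic terms then cancel.
  have hf : ContDiffOn ℝ 1 (fun x => q x / r x) V := hq.div hr hr0
  refine (hflat.mul hV hf).congr (fun x hx => ?_) (fun x hx => ?_) fun x hx => ?_
  all_goals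
    have hrx := hr0 x hx
    have hqx := (hC.pos_q x hx).ne'
    obtain ⟨e1, e2, e3, e4, e5, e6⟩ := hC.christoffel_eq hV hh hr hc hq hx
  · rw [e1]
    field_simp
  · rw [e2]
    field_simp
  · have hdf : ∀ i, pd i (fun x => q x / r x) x = (pd i q x - q x / r x * pd i r x) / r x := by
      intro i
      have e := pd_mul (i := i) (differentiableAt_of_contDiffOn hV hf hx)
        (differentiableAt_of_contDiffOn hV hr hx)
      rw [pd_congr_on (v := q) hV (fun y hy => div_mul_cancel₀ _ (hr0 y hy)) hx] at e
      rw [eq_div_iff hrx]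
      linarith
    have hω : pd 0 q x = r x * connectionForm₁ r c q x - c x * connectionForm₀ r c q x := by
      rw [connectionForm₁]
      field_simp
      ring
    rw [Fin.sum_univ_two, hdf, hdf, e1, e2, e3, e4, e5, e6, hω]
    field_simp
    ring

end ConnectionForm

/-- A flat metric of class `C^{n-1}` on the plane, flatness being understood weakly, is locally
`dz₀² + dz₁²` for functions `z₀`, `z₁` of class `C^n` with linearly independent differentials. -/
theorem exists_flat_coordinates {n : ℕ∞} (hn : 2 ≤ n) (hV : IsOpen V)
    (hh : ∀ m : ℕ∞, m + 1 ≤ n → IsRiemannianMetricOn m V h)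
    (hflat : HasWeakCurl V (christoffel h 1 0 0) (christoffel h 1 1 0) (fun x =>
      ∑ p : Fin 2, (christoffel h 1 0 p x * christoffel h p 1 0 x -
        christoffel h 1 1 p x * christoffel h p 0 0 x))) {p : Plane} (hp : p ∈ V) :
    ∃ s > 0, ball p s ⊆ V ∧ ∃ y : Fin 2 → Plane → ℝ,
      (∀ a, ContDiffOn ℝ (n : WithTop ℕ∞) (y a) (ball p s)) ∧
      (∀ x ∈ ball p s, ∀ i j, h x i j = ∑ a, pd i (y a) x * pd j (y a) x) ∧
      ∀ x ∈ ball p s, pd 0 (y 0) x * pd 1 (y 1) x - pd 1 (y 0) x * pd 0 (y 1) x ≠ 0 := by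
  have hh1 : IsRiemannianMetricOn 1 V h := hh 1 (by norm_num; exact hn)
  obtain ⟨r, c, q, hC, hreg⟩ := exists_isCholeskyOn hh1
  obtain ⟨hr, hc, hq⟩ := hreg 1 hh1
  have hr' : ContDiffOn ℝ 1 r V := by simpa using hr
  have hc' : ContDiffOn ℝ 1 c V := by simpa using hc
  have hq' : ContDiffOn ℝ 1 q V := by simpa using hq
  obtain ⟨s, hs, hsV, θ, hθ⟩ :=
    (hC.hasWeakCurl_connectionForm hV hh1 hr' hc' hq' hflat).exists_primitive hV hp
  have hθ0 : ∀ x ∈ ball p s, pd 0 θ x = connectionForm₀ r c q x := fun x hx =>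
    (pd_eq_of_hasFDerivAt_oneForm (hθ x hx)).1
  have hθ1 : ∀ x ∈ ball p s, pd 1 θ x = connectionForm₁ r c q x := fun x hx =>
    (pd_eq_of_hasFDerivAt_oneForm (hθ x hx)).2
  have hθd : ∀ x ∈ ball p s, DifferentiableAt ℝ θ x := fun x hx => (hθ x hx).differentiableAt
  have hreg' : ∀ k : ℕ, ((k : ℕ∞) + 1 ≤ n) → ContDiffOn ℝ k r (ball p s) ∧
      ContDiffOn ℝ k c (ball p s) ∧ ContDiffOn ℝ k q (ball p s) := fun k hk => by
    obtain ⟨h1, h2, h3⟩ := hreg k (hh k hk)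
    exact ⟨h1.mono hsV, h2.mono hsV, h3.mono hsV⟩
  -- The connection form costs one derivative of the coframe and integration to `θ` recovers it, so
  -- the rotated coframe is as regular as `h` and its primitives gain one more derivative, reaching
  -- C^n.
  have hθreg : ∀ k : ℕ, ((k : ℕ∞) + 1 ≤ n) → ContDiffOn ℝ k θ (ball p s) := by
    intro k hk
    rcases k with _ | k
    · simp only [Nat.cast_zero, contDiffOn_zero]
      exact fun x hx => (hθd x hx).continuousAt.continuousWithinAt
    · obtain ⟨h1, h2, h3⟩ := hreg' (k + 1) hk
      have hle : ((k : ℕ) : WithTop ℕ∞) ≤ ((k + 1 : ℕ) : WithTop ℕ∞) := by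
        exact_mod_cast Nat.le_succ k
      have hpd : ∀ {u : Plane → ℝ}, ContDiffOn ℝ ((k + 1 : ℕ) : WithTop ℕ∞) u (ball p s) →
          ∀ i, ContDiffOn ℝ k (pd i u) (ball p s) := fun hu i =>
        contDiffOn_pd isOpen_ball hu (by push_cast; exact le_rfl) i
      have hω0 : ContDiffOn ℝ k (connectionForm₀ r c q) (ball p s) :=
        ((hpd h2 0).sub (hpd h1 1)).div (h3.of_le hle) fun x hx => (hC.pos_q x (hsV hx)).ne'
      have hω1 : ContDiffOn ℝ k (connectionForm₁ r c q) (ball p s) :=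
        ((hpd h3 0).add ((h2.of_le hle).mul hω0)).div (h1.of_le hle)
          fun x hx => (hC.pos_r x (hsV hx)).ne'
      push_cast
      refine contDiffOn_of_pd isOpen_ball hθd fun i => ?_
      fin_cases i
      · exact hω0.congr hθ0
      · exact hω1.congr hθ1
  -- the coframe rotated by the angle `θ`
  set b : Fin 2 → Fin 2 → Plane → ℝ :=
    ![![fun x => Real.cos (θ x) * r x, fun x => Real.cos (θ x) * c x - Real.sin (θ x) * q x],
      ![fun x => Real.sin (θ x) * r x, fun x => Real.sin (θ x) * c x + Real.cos (θ x) * q x]]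
    with hb
  have hbreg : ∀ k : ℕ, ((k : ℕ∞) + 1 ≤ n) → ∀ a i, ContDiffOn ℝ k (b a i) (ball p s) := by
    intro k hk a i
    obtain ⟨h1, h2, h3⟩ := hreg' k hk
    have hcos := Real.contDiff_cos.comp_contDiffOn (hθreg k hk)
    have hsin := Real.contDiff_sin.comp_contDiffOn (hθreg k hk)
    fin_cases a <;> fin_cases i
    · exact hcos.mul h1
    · exact (hcos.mul h2).sub (hsin.mul h3)
    · exact hsin.mul h1
    · exact (hsin.mul h2).add (hcos.mul h3)
  have hb1 : ∀ a i, ContDiffOn ℝ 1 (b a i) (ball p s) := fun a i => by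
    simpa using hbreg 1 (by norm_num; exact hn) a i
  -- For `e⁰ = r dx⁰ + c dx¹` and `e¹ = q dx¹` the connection form `ω` is defined by `de⁰ = ω ∧ e¹`
  -- and `de¹ = -ω ∧ e⁰`. With `dθ = ω` these terms cancel the derivatives of `cos θ` and `sin θ`.
  have hclosed : ∀ a, ∀ x ∈ ball p s, pd 1 (b a 0) x = pd 0 (b a 1) x := by
    intro a x hx
    have dr := differentiableAt_of_contDiffOn hV hr' (hsV hx)
    have dc := differentiableAt_of_contDiffOn hV hc' (hsV hx)
    have dq := differentiableAt_of_contDiffOn hV hq' (hsV hx)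
    have dcos : DifferentiableAt ℝ (fun y => Real.cos (θ y)) x := (hθd x hx).cos
    have dsin : DifferentiableAt ℝ (fun y => Real.sin (θ y)) x := (hθd x hx).sin
    have pcos : ∀ i, pd i (fun y => Real.cos (θ y)) x = - Real.sin (θ x) * pd i θ x := by
      intro i
      rw [pd, fderiv_cos (hθd x hx)]
      simp [pd]
    have psin : ∀ i, pd i (fun y => Real.sin (θ y)) x = Real.cos (θ x) * pd i θ x := by
      intro i
      rw [pd, fderiv_sin (hθd x hx)]
      simp [pd]
    have hrx := (hC.pos_r x (hsV hx)).ne'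
    have hqx := (hC.pos_q x (hsV hx)).ne'
    have w0 : q x * connectionForm₀ r c q x = pd 0 c x - pd 1 r x := by
      rw [connectionForm₀]
      field_simp
    have w1 : r x * connectionForm₁ r c q x = pd 0 q x + c x * connectionForm₀ r c q x := by
      rw [connectionForm₁]
      field_simp
    fin_cases a
    · change pd 1 (fun x => Real.cos (θ x) * r x) x =
        pd 0 (fun x => Real.cos (θ x) * c x - Real.sin (θ x) * q x) x
      rw [pd_mul dcos dr, pd_sub (dcos.fun_mul dc) (dsin.fun_mul dq), pd_mul dcos dc, pd_mul dsin dq,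
        pcos, pcos, psin, hθ0 x hx, hθ1 x hx]
      linear_combination - Real.sin (θ x) * w1 + Real.cos (θ x) * w0
    · change pd 1 (fun x => Real.sin (θ x) * r x) x =
        pd 0 (fun x => Real.sin (θ x) * c x + Real.cos (θ x) * q x) x
      rw [pd_mul dsin dr, pd_add (dsin.fun_mul dc) (dcos.fun_mul dq), pd_mul dsin dc, pd_mul dcos dq,
        pcos, psin, psin, hθ0 x hx, hθ1 x hx]
      linear_combination Real.cos (θ x) * w1 + Real.sin (θ x) * w0
  choose y hy using fun a => exists_primitive_of_contDiff (convex_ball p s) isOpen_ball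
    (hb1 a 0) (hb1 a 1) (hclosed a)
  have hpd : ∀ a i, ∀ x ∈ ball p s, pd i (y a) x = b a i x := by
    intro a i x hx
    have := pd_eq_of_hasFDerivAt_oneForm (hy a x hx)
    fin_cases i
    exacts [this.1, this.2]
  refine ⟨s, hs, hsV, y, fun a => ?_, fun x hx i j => ?_, fun x hx => ?_⟩
  · have hsucc : ∀ k : ℕ, ((k : ℕ∞) + 1 ≤ n) → ContDiffOn ℝ ((k : WithTop ℕ∞) + 1) (y a)
        (ball p s) := fun k hk => contDiffOn_of_pd isOpen_ball
      (fun x hx => (hy a x hx).differentiableAt) fun i => (hbreg k hk a i).congr (hpd a i)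
    -- Finite orders suffice, which includes `n = ∞`; order `k + 1` of `y a` comes from order `k` of
    -- the coframe.
    rw [contDiffOn_iff_forall_nat_le]
    intro m hm
    rcases m with _ | k
    · exact (hsucc 0 (by simpa using le_trans (by norm_num) hn)).of_le (by simp)
    · exact_mod_cast hsucc k (by exact_mod_cast hm)
  · have e00 := hC.eq00 x (hsV hx)
    have e01 := hC.eq01 x (hsV hx)
    have e10 := (hh1.symm (hsV hx) 1 0).trans e01
    have e11 := hC.eq11 x (hsV hx)
    have hcs := Real.sin_sq_add_cos_sq (θ x)
    simp only [fun a i => hpd a i x hx, Fin.sum_univ_two]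
    fin_cases i <;> fin_cases j <;> simp only [hb] <;> simp
    · rw [e00]
      linear_combination - (r x * r x) * hcs
    · rw [e01]
      linear_combination - (r x * c x) * hcs
    · rw [e10]
      linear_combination - (r x * c x) * hcs
    · rw [e11]
      linear_combination - (c x * c x + q x * q x) * hcs
  · have hcs := Real.sin_sq_add_cos_sq (θ x)
    have hrq := mul_pos (hC.pos_r x (hsV hx)) (hC.pos_q x (hsV hx))
    simp only [fun a i => hpd a i x hx]
    have : b 0 0 x * b 1 1 x - b 0 1 x * b 1 0 x = r x * q x := by
      simp only [hb]
      simp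
      linear_combination (r x * q x) * hcs
    rw [this]
    exact hrq.ne'

/-- Functions with linearly independent differentials are local coordinates. -/
theorem exists_openPartialHomeomorph {n : ℕ∞} (hn : n ≠ 0) (hV : IsOpen V) {y : Fin 2 → Plane → ℝ}
    (hy : ∀ a, ContDiffOn ℝ (n : WithTop ℕ∞) (y a) V)
    (hdet : ∀ x ∈ V, pd 0 (y 0) x * pd 1 (y 1) x - pd 1 (y 0) x * pd 0 (y 1) x ≠ 0)
    {p : Plane} (hp : p ∈ V) :
    ∃ e : OpenPartialHomeomorph Plane Plane, p ∈ e.source ∧ e.source ⊆ V ∧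
      ContDiffOn ℝ (n : WithTop ℕ∞) e e.source ∧
      ContDiffOn ℝ (n : WithTop ℕ∞) e.symm e.target ∧ ∀ a, (fun x => e x a) = y a := by
  have hn' : (n : WithTop ℕ∞) ≠ 0 := by exact_mod_cast hn
  set Φ : Plane → Plane := fun x => WithLp.toLp 2 fun a => y a x with hΦ
  have hΦc : ContDiffOn ℝ (n : WithTop ℕ∞) Φ V := contDiffOn_euclidean.mpr hy
  have hΦat : ∀ x ∈ V, ContDiffAt ℝ (n : WithTop ℕ∞) Φ x := fun x hx =>
    hΦc.contDiffAt (hV.mem_nhds hx)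
  have hequiv : ∀ x ∈ V, ∃ T : Plane ≃L[ℝ] Plane, HasFDerivAt Φ (T : Plane →L[ℝ] Plane) x := by
    intro x hx
    have hd := ((hΦat x hx).differentiableAt hn').hasFDerivAt
    have hcoord : ∀ a v, fderiv ℝ Φ x v a = pd 0 (y a) x * v 0 + pd 1 (y a) x * v 1 := by
      intro a v
      have h1 : HasFDerivAt (y a) _ x := (EuclideanSpace.proj a : Plane →L[ℝ] ℝ).hasFDerivAt.comp x hd
      have h2 := congrArg (fun T : Plane →L[ℝ] ℝ => T v) h1.fderiv
      simp only [fderiv_eq_oneForm, oneForm_apply] at h2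
      rw [h2]
      rfl
    have hinj : Function.Injective (fderiv ℝ Φ x : Plane →ₗ[ℝ] Plane) := by
      rw [← LinearMap.ker_eq_bot, LinearMap.ker_eq_bot']
      intro v hv
      have h0 := hcoord 0 v
      have h1 := hcoord 1 v
      have hv' : fderiv ℝ Φ x v = 0 := hv
      rw [hv'] at h0 h1
      simp only [PiLp.zero_apply] at h0 h1
      have hd := hdet x hx
      ext i
      fin_cases i
      · change v 0 = 0
        refine (mul_eq_zero.mp ?_).resolve_left hd
        linear_combination - pd 1 (y 1) x * h0 + pd 1 (y 0) x * h1
      · change v 1 = 0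
        refine (mul_eq_zero.mp ?_).resolve_left hd
        linear_combination pd 0 (y 1) x * h0 - pd 0 (y 0) x * h1
    exact ⟨(LinearEquiv.ofInjectiveEndo _ hinj).toContinuousLinearEquiv, hd⟩
  obtain ⟨T, hT⟩ := hequiv p hp
  set e₀ := (hΦat p hp).toOpenPartialHomeomorph Φ hT hn'
  have he₀ : ∀ x, e₀ x = Φ x := fun x => rfl
  refine ⟨e₀.restrOpen V hV, ⟨(hΦat p hp).mem_toOpenPartialHomeomorph_source hT hn', hp⟩,
    inter_subset_right, hΦc.mono inter_subset_right, fun w hw => ?_, fun a => rfl⟩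
  -- The source was cut down to `V`, where the differential is invertible at every point, so the
  -- inverse is C^n on the whole target and not only near the image of `p`.
  have hw' : (e₀.restrOpen V hV).symm w ∈ V := ((e₀.restrOpen V hV).map_target hw).2
  obtain ⟨T', hT'⟩ := hequiv _ hw'
  exact ((e₀.restrOpen V hV).contDiffAt_symm hw hT' (hΦat _ hw')).contDiffWithinAt

lemma isIsometricEmbeddingOn_of_coordinates {n : ℕ∞} {e : OpenPartialHomeomorph Plane Plane}
    (he : ContDiffOn ℝ (n : WithTop ℕ∞) e e.source)
    (hz : ContDiffOn ℝ (n : WithTop ℕ∞) z e.source)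
    (hmetric : ∀ x ∈ e.source, ∀ i j : Fin 2, subSq g z x i j =
      ∑ a : Fin 2, pd i (fun y => e y a) x * pd j (fun y => e y a) x) :
    IsIsometricEmbeddingOn n e.source g (fun x => !₂[e x 0, e x 1, z x]) := by
  have hF : ContDiffOn ℝ (n : WithTop ℕ∞) (fun x => !₂[e x 0, e x 1, z x]) e.source := by
    rw [contDiffOn_euclidean] at he ⊢
    intro i
    fin_cases i
    exacts [he 0, he 1, hz]
  refine ⟨⟨hF, fun x hx i j => ?_⟩, ?_⟩
  · have h1 := hmetric x hx i j
    simp only [subSq, Matrix.of_apply, Fin.sum_univ_two] at h1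
    rw [Fin.sum_univ_three]
    change pd i (fun y => e y 0) x * pd j (fun y => e y 0) x +
      pd i (fun y => e y 1) x * pd j (fun y => e y 1) x + pd i z x * pd j z x = g x i j
    linarith
  · have hc : Continuous fun w : Space => (!₂[w 0, w 1] : Plane) := by fun_prop
    refine IsEmbedding.of_comp (continuousOn_iff_continuous_domRestrict.mp hF.continuousOn) hc ?_
    convert e.isOpenEmbedding_restrict.isEmbedding using 1
    ext x i
    fin_cases i <;> rfl

end

/-! ### Local equivalence of the two problems -/

section

variable {V : Set Plane} {g : Plane → Matrix (Fin 2) (Fin 2) ℝ} {x : Plane} {z : Plane → ℝ}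

lemma continuousOn_gradNormSq (hg : IsRiemannianMetricOn 1 V g) (hV : IsOpen V)
    (hz : ContDiffOn ℝ 1 z V) : ContinuousOn (gradNormSq g z) V := by
  have h1 := fun i => continuousOn_pd hV hz i
  have h2 := fun i j => (hg.contDiffOn_inv i j).continuousOn
  exact continuousOn_finsetSum _ fun i _ => continuousOn_finsetSum _ fun j _ =>
    ((h2 i j).mul (h1 i)).mul (h1 j)

/-- The sum is the trace of `g⁻¹ g`. -/
lemma IsIsometricImmersionOn.sum_gradNormSq {n m : ℕ∞} {F : Plane → Space}
    (hg : IsRiemannianMetricOn m V g) (hF : IsIsometricImmersionOn n V g F) (hx : x ∈ V) :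
    ∑ α, gradNormSq g (fun y => F y α) x = 2 := by
  have hd := (hg.det_pos hx).ne'
  have e00 := hF.isometric x hx 0 0
  have e01 := hF.isometric x hx 0 1
  have e11 := hF.isometric x hx 1 1
  simp only [hg.gradNormSq_eq hx, ← Finset.sum_div]
  rw [div_eq_iff hd, hg.det_eq hx]
  rw [Fin.sum_univ_three] at e00 e01 e11 ⊢
  linear_combination g x 1 1 * e00 - 2 * g x 0 1 * e01 + g x 0 0 * e11

theorem exists_flat_coordinates_isIsometricEmbeddingOn {n : ℕ∞} (hn : 2 ≤ n)
    (hg : IsRiemannianMetricOn n V g) (hV : IsOpen V) (hz : ContDiffOn ℝ (n : WithTop ℕ∞) z V)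
    (hdar : SatisfiesDarbouxOn g V z) (hz1 : ∀ x ∈ V, gradNormSq g z x < 1) {p : Plane}
    (hp : p ∈ V) : ∃ e : OpenPartialHomeomorph Plane Plane,
      p ∈ e.source ∧ e.source ⊆ V ∧ ContDiffOn ℝ (n : WithTop ℕ∞) e e.source ∧
      ContDiffOn ℝ (n : WithTop ℕ∞) e.symm e.target ∧
      (∀ x ∈ e.source, ∀ i j : Fin 2, subSq g z x i j =
        ∑ a : Fin 2, pd i (fun y => e y a) x * pd j (fun y => e y a) x) ∧
      IsIsometricEmbeddingOn n e.source g (fun x => !₂[e x 0, e x 1, z x]) := by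
  have hz2 : ContDiffOn ℝ 2 z V :=
    hz.of_le (show ((2 : ℕ∞) : WithTop ℕ∞) ≤ n by exact_mod_cast hn)
  obtain ⟨s, hs, hsV, y, hyc, hym, hyd⟩ := exists_flat_coordinates hn hV
    (fun m hm => hg.subSq hV hz hz1 hm)
    (hasWeakCurl_christoffel_subSq (hg.of_le hn) hV hz2 hz1 hdar 1 0) hp
  obtain ⟨e, hpe, heV, hec, hes, hey⟩ := exists_openPartialHomeomorph
    (fun h0 => by simp [h0] at hn) isOpen_ball hyc hyd (mem_ball_self hs)
  have hm : ∀ x ∈ e.source, ∀ i j : Fin 2, subSq g z x i j =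
      ∑ a : Fin 2, pd i (fun y => e y a) x * pd j (fun y => e y a) x := fun x hx i j => by
    simp only [hey]
    exact hym x (heV hx) i j
  exact ⟨e, hpe, heV.trans hsV, hec, hes, hm,
    isIsometricEmbeddingOn_of_coordinates hec (hz.mono (heV.trans hsV)) hm⟩

theorem exists_darboux_solution_of_isIsometricImmersionOn {n : ℕ∞} (hn : 2 ≤ n)
    (hg : IsRiemannianMetricOn n V g) (hV : IsOpen V) {F : Plane → Space}
    (hF : IsIsometricImmersionOn n V g F) {p : Plane} (hp : p ∈ V) :
    ∃ (W : Set Plane) (z : Plane → ℝ), IsOpen W ∧ p ∈ W ∧ W ⊆ V ∧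
      ContDiffOn ℝ (n : WithTop ℕ∞) z W ∧ SatisfiesDarbouxOn g W z ∧
      ∀ x ∈ W, gradNormSq g z x < 1 := by
  -- Three numbers with sum 2 cannot all be at least 1; continuity keeps the chosen one below 1 near
  -- `p`.
  obtain ⟨α, hα⟩ : ∃ α, gradNormSq g (fun y => F y α) p < 1 := by
    by_contra! h
    have h1 := hF.sum_gradNormSq hg hp
    rw [Fin.sum_univ_three] at h1
    linarith [h 0, h 1, h 2]
  have hn1 : (1 : ℕ∞) ≤ n := le_trans (by norm_num) hn
  have hc := continuousOn_gradNormSq (hg.of_le hn1) hV ((hF.of_le hn1).contDiffOn_apply α)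
  have hW : V ∩ gradNormSq g (fun y => F y α) ⁻¹' Iio 1 ⊆ V := inter_subset_left
  have hWo := hc.isOpen_inter_preimage hV (isOpen_Iio (a := 1))
  exact ⟨_, fun y => F y α, hWo, ⟨hp, hα⟩, hW, (hF.contDiffOn_apply α).mono hW,
    ((hF.of_le hn).mono hW).satisfiesDarbouxOn hWo ((hg.of_le hn).mono hW) α, fun x hx => hx.2⟩

end

end LocalSurface

end

theorem mainTheorem3 (n : ℕ∞) (hn : 2 ≤ n)
    (U : Set LocalSurface.Plane) (hU : IsOpen U)
    (g : LocalSurface.Plane → Matrix (Fin 2) (Fin 2) ℝ)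
    (hg : LocalSurface.IsRiemannianMetricOn n U g) :
    -- every component of a C² isometric map into three-space solves the Darboux equation
    (∀ V : Set LocalSurface.Plane, IsOpen V → V ⊆ U →
      ∀ F : LocalSurface.Plane → LocalSurface.Space,
        LocalSurface.IsIsometricImmersionOn 2 V g F →
        ∀ α : Fin 3, LocalSurface.SatisfiesDarbouxOn g V (fun x => F x α)) ∧
    -- conversely, for a solution of class C^n with gradient shorter than 1
    (∀ V : Set LocalSurface.Plane, IsOpen V → V ⊆ U →
      ∀ z : LocalSurface.Plane → ℝ, ContDiffOn ℝ (n : WithTop ℕ∞) z V →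
        LocalSurface.SatisfiesDarbouxOn g V z →
        (∀ x ∈ V, LocalSurface.gradNormSq g z x < 1) →
        -- `g - dz²` is a Riemannian metric, of class C^(n-1)
        (∀ m : ℕ∞, m + 1 ≤ n →
          LocalSurface.IsRiemannianMetricOn m V (LocalSurface.subSq g z)) ∧
        -- it is flat
        LocalSurface.IsWeaklyFlatOn (LocalSurface.subSq g z) V ∧
        (3 ≤ n → ∀ x ∈ V, LocalSurface.gaussCurvature (LocalSurface.subSq g z) x = 0) ∧
        -- near every point there are coordinates (z₁, z₂) with `g - dz² = dz₁² + dz₂²`,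
        -- and (z₁, z₂, z) is an isometric embedding
        (∀ p ∈ V, ∃ e : OpenPartialHomeomorph LocalSurface.Plane LocalSurface.Plane,
          p ∈ e.source ∧ e.source ⊆ V ∧
          ContDiffOn ℝ (n : WithTop ℕ∞) e e.source ∧
          ContDiffOn ℝ (n : WithTop ℕ∞) e.symm e.target ∧
          (∀ x ∈ e.source, ∀ i j : Fin 2, LocalSurface.subSq g z x i j =
            ∑ a : Fin 2, LocalSurface.pd i (fun y => e y a) x *
              LocalSurface.pd j (fun y => e y a) x) ∧
          LocalSurface.IsIsometricEmbeddingOn n e.source g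
            (fun x => !₂[e x 0, e x 1, z x]))) ∧
    -- hence the two local solvability problems are equivalent
    (∀ p ∈ U,
      (∃ (V : Set LocalSurface.Plane) (F : LocalSurface.Plane → LocalSurface.Space),
        IsOpen V ∧ p ∈ V ∧ V ⊆ U ∧ LocalSurface.IsIsometricEmbeddingOn n V g F) ↔
      (∃ (V : Set LocalSurface.Plane) (z : LocalSurface.Plane → ℝ),
        IsOpen V ∧ p ∈ V ∧ V ⊆ U ∧ ContDiffOn ℝ (n : WithTop ℕ∞) z V ∧
        LocalSurface.SatisfiesDarbouxOn g V z ∧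
        ∀ x ∈ V, LocalSurface.gradNormSq g z x < 1)) := by
  refine ⟨fun V hV hVU F hF α => hF.satisfiesDarbouxOn hV ((hg.of_le hn).mono hVU) α,
    fun V hV hVU z hz hdar hz1 => ?_, fun p hp => ⟨?_, ?_⟩⟩
  · have hgV := hg.mono hVU
    have hz2 : ContDiffOn ℝ 2 z V :=
      hz.of_le (show ((2 : ℕ∞) : WithTop ℕ∞) ≤ n by exact_mod_cast hn)
    exact ⟨fun m hm => hgV.subSq hV hz hz1 hm,
      LocalSurface.isWeaklyFlatOn_of_hasWeakCurl
        (LocalSurface.hasWeakCurl_christoffel_subSq (hgV.of_le hn) hV hz2 hz1 hdar),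
      fun hn3 x hx => LocalSurface.gaussCurvature_subSq hn3 hgV hV hz hz1 hdar hx,
      fun p hp => LocalSurface.exists_flat_coordinates_isIsometricEmbeddingOn hn hgV hV hz hdar
        hz1 hp⟩
  · rintro ⟨V, F, hV, hpV, hVU, hF⟩
    obtain ⟨W, z, hW, hpW, hWV, h⟩ :=
      LocalSurface.exists_darboux_solution_of_isIsometricImmersionOn hn (hg.mono hVU) hV
        hF.toIsIsometricImmersionOn hpV
    exact ⟨W, z, hW, hpW, hWV.trans hVU, h⟩
  · rintro ⟨V, z, hV, hpV, hVU, hz, hdar, hz1⟩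
    obtain ⟨e, hpe, heV, -, -, -, he⟩ :=
      LocalSurface.exists_flat_coordinates_isIsometricEmbeddingOn hn (hg.mono hVU) hV hz hdar
        hz1 hpV
    exact ⟨e.source, _, e.open_source, hpe, heV.trans hVU, he⟩
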